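/- Let $\nu\ge 1$ and let $\Phi_k:(\mathbb R^{\nu})^k\to\mathbb R$, $k\ge1$, be symmetric potentials of class $C^2$ such that for every $n\ge 1$ all solutions of the Hamilton equations of $$H_n=\sum_{i=1}^n\frac{p_i^2}{2}+\sum_{k=1}^n\sum_{i_1<\dots<i_k}\Phi_k(q_{i_1},\dots,q_{i_k})$$ exist for all times. Write $x_i=(q_i,p_i)\in\mathbb R^\nu\times\mathbb R^\nu$, and $x_X=(x_i)_{i\in X}$ for $X\subset\{1,\dots,n\}$. For a nonempty set $s=\{i_1<\dots<i_k\}$ put $$\mathcal L^{int}_{s}=-\sum_{j\in s}\Big\langle \frac{\partial}{\partial q_j}\Phi_k(q_{i_1},\dots,q_{i_k}),\frac{\partial}{\partial p_j}\Big\rangle ,\qquad \mathcal L_n=\sum_{i=1}^n\Big\langle p_i,\frac{\partial}{\partial q_i}\Big\rangle+\sum_{\emptyset\ne s\subset\{1,\dots,n\}}\mathcal L^{int}_{s}.$$ The nonlinear Liouville hierarchy is the system, for $n\ge 1$, $$\frac{d}{dt}g_n(t)=-\mathcal L_n g_n(t)+\sum_{P,\ |P|>1}\ \sum_{s:\ s\cap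 X\neq\emptyset\ \forall X\in P}\big(-\mathcal L^{int}_{s}\big)\prod_{X\in P}g_{|X|}(t,x_X),$$ where $P$ runs over the partitions of $\{1,\dots,n\}$ into nonempty blocks and $s$ over the subsets of $\{1,\dots,n\}$ that meet every block of $P$. Let $L^1_n$ be the space of symmetric integrable functions of $(x_1,\dots,x_n)$, with its $L^1$ norm, and let $L^1_{n,0}\subset L^1_n$ be the subspace of continuously differentiable functions with compact support. A strong solution is a sequence of functions $t\mapsto g_n(t)\in L^1_n$, $t\in\mathbb R$, $n\ge1$, differentiable in the norm of $L^1$ and satisfying the hierarchy for every $t\in\mathbb R$, where the differential operators act on $L^1$ functions in the sense of distributions and the derivative $\frac{d}{dt}g_n(t)\in L^1_n$ equals the right-hand side. Theorem. If $g_n(0)\in L^1_{n,0}$ for all $n\ge 1$, then the hierarchy has exactly one strong solution $(g_n(t))_{n\ge1}$, $t\in\mathbb R$, with these initial data. It is given by $$g_n(t)=\sum_{P}\mathfrak A_{|P|}(t,P)\prod_{X\in P}g_{|X|}(0,x_X),\qquad \mathfrak A_{|P|}(t,P)=\sum_{P'\ge P}(-1)^{|P'|-1}(|P'|-1)!\prod_{Z\in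 P'}S_{|Z|}(-t,x_Z),$$ where $P'$ runs over the partitions of $\{1,\dots,n\}$ whose blocks are unions of blocks of $P$, and $S_k(-t)f=f\circ X^{(k)}(-t,\cdot)$ with $X^{(k)}(t,\cdot)$ the Hamiltonian flow of $H_k$. Moreover $g_n(t)\in L^1_{n,0}$ for all $t$, so that the hierarchy holds with classical derivatives on the right-hand side, and $$\|g_n(t)\|\le n!\,e^{n+1}\sum_{P}\prod_{X\in P}\|g_{|X|}(0)\|.$$ -/

import Mathlib

open MeasureTheory
open scoped Nat

noncomputable section

/-- The one-particle phase space: pairs `x = (q, p)` of a position and a momentum. -/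
abbrev Phase (ν : ℕ) : Type := EuclideanSpace ℝ (Fin ν) × EuclideanSpace ℝ (Fin ν)

/-- The phase space of `n` particles. Its `volume` is Lebesgue measure. -/
abbrev PhaseN (ν n : ℕ) : Type := Fin n → Phase ν

/-- A family `Φ₁, Φ₂, …` of `k`-body potentials (the entry `k = 0` is never used). -/
abbrev Potentials (ν : ℕ) : Type := (k : ℕ) → (Fin k → EuclideanSpace ℝ (Fin ν)) → ℝ

/-- A sequence of functions of `n` phase points (the entry `n = 0` is never used). -/
abbrev CorrSeq (ν : ℕ) : Type := (n : ℕ) → PhaseN ν n → ℝ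

/-- Integrable functions on the `n`-particle phase space, modulo null sets. -/
abbrev L1 (ν n : ℕ) : Type := Lp ℝ 1 (volume : Measure (PhaseN ν n))

/-- The subcollection `x_X` of the phase points with label in `X`, in increasing order. -/
def restr {α : Type*} {n : ℕ} (X : Finset (Fin n)) (x : Fin n → α) : Fin X.card → α :=
  fun j => x (X.orderEmbOfFin rfl j)

/-- `∂F/∂q_i`. -/
def gradQ {ν n : ℕ} (i : Fin n) (F : PhaseN ν n → ℝ) (x : PhaseN ν n) :
    EuclideanSpace ℝ (Fin ν) :=
  gradient (fun y => F (Function.update x i (y, (x i).2))) (x i).1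

/-- `∂F/∂p_i`. -/
def gradP {ν n : ℕ} (i : Fin n) (F : PhaseN ν n → ℝ) (x : PhaseN ν n) :
    EuclideanSpace ℝ (Fin ν) :=
  gradient (fun y => F (Function.update x i ((x i).1, y))) (x i).2

/-- `Φ_k(q_{i₁}, …, q_{i_k})` for the set of labels `s = {i₁ < … < i_k}`. -/
def groupPotential {ν n : ℕ} (Φ : Potentials ν) (s : Finset (Fin n)) (x : PhaseN ν n) : ℝ :=
  Φ s.card (restr s fun i => (x i).1)

/-- The Hamiltonian `H_n`. -/
def hamiltonian {ν n : ℕ} (Φ : Potentials ν) (x : PhaseN ν n) : ℝ :=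
  ∑ i, ‖(x i).2‖ ^ 2 / 2 + ∑ s : Finset (Fin n) with s.Nonempty, groupPotential Φ s x

/-- `γ` solves the Hamilton equations `q̇_i = ∂H/∂p_i`, `ṗ_i = -∂H/∂q_i` for all times. -/
def IsHamiltonCurve {ν n : ℕ} (Φ : Potentials ν) (γ : ℝ → PhaseN ν n) : Prop :=
  ∀ t, HasDerivAt γ
    (fun i => (gradP i (hamiltonian Φ) (γ t), -gradQ i (hamiltonian Φ) (γ t))) t

/-- The standing assumptions on the potentials: the particles are identical, the potentials are
smooth enough for the Hamilton equations to be well posed, and the solutions of the Hamilton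
equations of any number of particles exist globally in time. -/
structure AdmissiblePotentials {ν : ℕ} (Φ : Potentials ν) : Prop where
  symm : ∀ k, 1 ≤ k → ∀ (σ : Equiv.Perm (Fin k)) (q : Fin k → EuclideanSpace ℝ (Fin ν)),
    Φ k (q ∘ σ) = Φ k q
  smooth : ∀ k, 1 ≤ k → ContDiff ℝ 2 (Φ k)
  global : ∀ n, 1 ≤ n → ∀ x : PhaseN ν n, ∃ γ : ℝ → PhaseN ν n, IsHamiltonCurve Φ γ ∧ γ 0 = x

open Classical in
/-- `X(t, x)`: the state at time `t` of the solution of the Hamilton equations which is at `x`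
at time `0`. -/
def hamiltonFlow {ν n : ℕ} (Φ : Potentials ν) (t : ℝ) (x : PhaseN ν n) : PhaseN ν n :=
  if h : ∃ γ : ℝ → PhaseN ν n, IsHamiltonCurve Φ γ ∧ γ 0 = x then h.choose t else x

/-- The particles with label in `Z` move for the time `t` as an isolated system of `|Z|`
particles, the other ones stay. So `F ↦ F ∘ clusterMove Φ Z (-t)` is the evolution operator
`S_{|Z|}(-t, Z)`, acting on the variables `x_Z`. -/
def clusterMove {ν n : ℕ} (Φ : Potentials ν) (Z : Finset (Fin n)) (t : ℝ) (x : PhaseN ν n) :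
    PhaseN ν n :=
  fun i => if h : i ∈ Z then
    hamiltonFlow Φ t (restr Z x) ((Z.orderIsoOfFin rfl).symm ⟨i, h⟩) else x i

/-- Every cluster of the partition `Q` moves as an isolated system. Distinct clusters involve
disjoint groups of variables, so `F ↦ F ∘ partitionMove Φ Q (-t)` is the product
`∏_{Z ∈ Q} S_{|Z|}(-t, Z)`. -/
def partitionMove {ν n : ℕ} (Φ : Potentials ν) (Q : Finpartition (Finset.univ : Finset (Fin n)))
    (t : ℝ) (x : PhaseN ν n) : PhaseN ν n :=
  fun i => clusterMove Φ (Q.part i) t x i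

open Classical in
/-- The cumulant `𝔄_{|P|}(t)` of order `|P|` of the evolution operators, whose arguments are the
blocks of `P`, applied to the function `F`. A partition of the set of blocks of `P` is
encoded as a partition `Q` of the set of labels which is coarser than `P` (`P ≤ Q`). -/
def cumulant {ν n : ℕ} (Φ : Potentials ν) (P : Finpartition (Finset.univ : Finset (Fin n)))
    (t : ℝ) (F : PhaseN ν n → ℝ) (x : PhaseN ν n) : ℝ :=
  ∑ Q : Finpartition (Finset.univ : Finset (Fin n)) with P ≤ Q,
    (-1) ^ (Q.parts.card - 1) * ((Q.parts.card - 1)! : ℝ) * F (partitionMove Φ Q (-t) x)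

/-- `∏_{X ∈ P} g_{|X|}(X)`. -/
def blockProd {ν n : ℕ} (g : CorrSeq ν) (P : Finpartition (Finset.univ : Finset (Fin n)))
    (x : PhaseN ν n) : ℝ :=
  ∏ X ∈ P.parts, g X.card (restr X x)

/-- The cluster expansion `∑_P 𝔄_{|P|}(t) ∏_{X ∈ P} g_{|X|}(0, X)`. -/
def clusterExpansion {ν : ℕ} (Φ : Potentials ν) (g₀ : CorrSeq ν) (t : ℝ) : CorrSeq ν :=
  fun n x => ∑ P : Finpartition (Finset.univ : Finset (Fin n)), cumulant Φ P t (blockProd g₀ P) x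

/-- The interaction part `ℒ^int_{|s|}` of the Liouville operator, for the group `s`. -/
def liouvilleInt {ν n : ℕ} (Φ : Potentials ν) (s : Finset (Fin n)) (f : PhaseN ν n → ℝ)
    (x : PhaseN ν n) : ℝ :=
  -∑ i ∈ s, inner ℝ (gradQ i (groupPotential Φ s) x) (gradP i f x)

/-- The Liouville operator `ℒ_n` of the Hamiltonian `H_n`. -/
def liouville {ν n : ℕ} (Φ : Potentials ν) (f : PhaseN ν n → ℝ) (x : PhaseN ν n) : ℝ :=
  ∑ i, inner ℝ (x i).2 (gradQ i f x) +
    ∑ s : Finset (Fin n) with s.Nonempty, liouvilleInt Φ s f x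

/-- The unions `⋃ Z_i` of families of nonempty subsets `Z_i` of the blocks `X_i` of `P`; the
family is determined by its union. -/
def transversals {n : ℕ} (P : Finpartition (Finset.univ : Finset (Fin n))) :
    Finset (Finset (Fin n)) :=
  {s | ∀ X ∈ P.parts, (s ∩ X).Nonempty}

/-- The right-hand side of the nonlinear Liouville hierarchy, with classical derivatives. -/
def hierarchyRHS {ν : ℕ} (Φ : Potentials ν) (g : CorrSeq ν) (n : ℕ) (x : PhaseN ν n) : ℝ :=
  -liouville Φ (g n) x +
    ∑ P : Finpartition (Finset.univ : Finset (Fin n)) with 1 < P.parts.card,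
      ∑ s ∈ transversals P, -liouvilleInt Φ s (blockProd g P) x

/-- Membership in `L¹_{n,0}`: symmetric, continuously differentiable, compactly supported. -/
structure IsL10 {ν n : ℕ} (f : PhaseN ν n → ℝ) : Prop where
  symm : ∀ (σ : Equiv.Perm (Fin n)) (x : PhaseN ν n), f (x ∘ σ) = f x
  smooth : ContDiff ℝ 1 f
  compact : HasCompactSupport f

/-- `v` is the right-hand side of the hierarchy at `g`, the differential operators acting on
integrable functions in their maximal domain, i.e. in the sense of distributions:
the Liouville operators are formally skew-adjoint. -/
def IsHierarchyRHS {ν : ℕ} (Φ : Potentials ν) (g : (n : ℕ) → L1 ν n) (n : ℕ) (v : L1 ν n) :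
    Prop :=
  ∀ ψ : PhaseN ν n → ℝ, ContDiff ℝ 1 ψ → HasCompactSupport ψ →
    (∫ x, v x * ψ x) =
      (∫ x, g n x * liouville Φ ψ x) +
        ∑ P : Finpartition (Finset.univ : Finset (Fin n)) with 1 < P.parts.card,
          ∑ s ∈ transversals P, ∫ x, blockProd (fun m => ⇑(g m)) P x * liouvilleInt Φ s ψ x

/-- Strong solutions of the nonlinear Liouville hierarchy: symmetric integrable functions
`u_n(t)`, `n ≥ 1`, differentiable in time in the norm of `L¹`, whose derivative is the
right-hand side of the hierarchy. -/
structure IsStrongSolution {ν : ℕ} (Φ : Potentials ν) (u : ℝ → (n : ℕ) → L1 ν n) : Prop where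
  symm : ∀ t n, 1 ≤ n → ∀ σ : Equiv.Perm (Fin n), ∀ᵐ x, u t n (x ∘ σ) = u t n x
  eqn : ∀ t n, 1 ≤ n → ∃ v : L1 ν n, HasDerivAt (fun s => u s n) v t ∧
    IsHierarchyRHS Φ (u t) n v

end

/-! The hierarchy is the logarithm of the linear Liouville equations. `partitionExp` sums the
products over the blocks of all partitions; `partitionLog`, with the weights c_k = (-1)^(k-1)
(k-1)!, inverts it, by the Möbius identity `sum_cumulantCoeff`. Let G_n(t) (`clusterSum`) be the
exponential of the initial data, transported by the full n-particle flow. The flow of the isolated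
clusters of Q acts block by block, so exchanging the sums over P ≤ Q identifies the cluster
expansion g(t) with the logarithm of G(t) (`clusterExpansion_eq`). Conversely the product of G over
the blocks of Q is the sum over P ≤ Q of the block products of g(t)
(`sum_blockProd_clusterExpansion`).

The product of G over the blocks of Q solves a linear transport equation which lacks exactly the
interactions of the groups s contained in no block of Q. Summing over Q with weight c_|Q| gives -ℒ_n
g_n plus terms ℒ^int_s ∏_P g, the coefficient being the sum of c_|Q| over the Q ≥ P none of whose
blocks contains s. Two uses of the Möbius identity evaluate it: -1 if |P| > 1 and s meets every
block of P, and 0 otherwise (`sum_cumulantCoeff_not_interacting`). This is the hierarchy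
(`hasDerivAt_clusterExpansion`).

The analysis rests on `IsGlobalFlow.contDiff`: global flows of C¹ fields are jointly C¹. Hence g_n
is jointly C¹ with support locally uniformly compact in time, and its pointwise time derivative is a
derivative in L¹ (`hasDerivAt_L1`). The fields are weakly divergence free, so their flows preserve
L¹ norms (`IsGlobalFlow.integral_abs_comp`), and the norm estimate reduces to a bound on the sum of
(|Q|-1)! (`sum_factorial_card_le`).

For uniqueness, the nonlinear terms at level n involve only lower levels. By induction the
difference of two solutions is a weak solution of the linear Liouville equation with zero initial
value; pairing it with test functions carried along the flow shows that it vanishes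
(`IsGlobalFlow.eq_zero_of_weak_transport`). -/

noncomputable section

/-! ### C¹ dependence of a global flow on time and initial point -/

section ODE
variable {E : Type*} [NormedAddCommGroup E] [NormedSpace ℝ E]

/-- Post-composition of `η` with a continuous family of linear maps. -/
def ContinuousMap.clmApply {K F : Type*} [TopologicalSpace K] [CompactSpace K]
    [NormedAddCommGroup F] [NormedSpace ℝ F] :
    C(K, E →L[ℝ] F) →L[ℝ] C(K, E) →L[ℝ] C(K, F) :=
  LinearMap.mkContinuous₂
    (LinearMap.mk₂ ℝ (fun (A : C(K, E →L[ℝ] F)) (η : C(K, E)) =>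
      (⟨fun s => A s (η s), by fun_prop⟩ : C(K, F)))
      (fun _ _ _ => by ext; simp) (fun _ _ _ => by ext; simp)
      (fun _ _ _ => by ext; simp) (fun _ _ _ => by ext; simp)) 1 (by
    intro A η
    rw [one_mul]
    refine (ContinuousMap.norm_le _ (by positivity)).2 fun s => ?_
    exact ((A s).le_opNorm _).trans
      (mul_le_mul (A.norm_coe_le_norm s) (η.norm_coe_le_norm s) (norm_nonneg _) (norm_nonneg A)))

@[simp] lemma ContinuousMap.clmApply_apply {K F : Type*} [TopologicalSpace K] [CompactSpace K]
    [NormedAddCommGroup F] [NormedSpace ℝ F] (A : C(K, E →L[ℝ] F)) (η : C(K, E)) (s : K) :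
    ContinuousMap.clmApply A η s = A s (η s) := rfl

/-- The range of `γ` is compact, so the derivative of `V` is uniformly continuous near it, and the
mean value inequality between `γ s` and `η s` gives a remainder uniform in `s`. -/
lemma ContinuousMap.hasFDerivAt_comp_left {K F : Type*} [TopologicalSpace K] [CompactSpace K]
    [NormedAddCommGroup F] [NormedSpace ℝ F] {V : E → F} (hV : ContDiff ℝ 1 V) (γ : C(K, E)) :
    HasFDerivAt (fun γ : C(K, E) => (⟨V, hV.continuous⟩ : C(E, F)).comp γ)
      (ContinuousMap.clmApply
        ((⟨fderiv ℝ V, hV.continuous_fderiv one_ne_zero⟩ : C(E, E →L[ℝ] F)).comp γ)) γ := by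
  refine HasFDerivAt.of_isLittleO (Asymptotics.isLittleO_iff.2 fun ε hε => ?_)
  have hc : IsCompact (Set.range γ) := isCompact_range γ.continuous
  have hu := hc.uniformContinuousAt_of_continuousAt (fderiv ℝ V)
    (fun a _ => (hV.continuous_fderiv one_ne_zero).continuousAt) (Metric.dist_mem_uniformity hε)
  obtain ⟨δ, hδ, hu⟩ := Metric.mem_uniformity_dist.1 hu
  filter_upwards [Metric.ball_mem_nhds γ hδ] with η hη
  refine (ContinuousMap.norm_le _ (by positivity)).2 fun s => ?_
  have hs : dist (η s) (γ s) < δ := (ContinuousMap.dist_apply_le_dist s).trans_lt hη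
  have key := (convex_ball (γ s) δ).norm_image_sub_le_of_norm_hasFDerivWithin_le'
    (f := V) (f' := fderiv ℝ V) (C := ε) (x := γ s) (y := η s)
    (fun z _ => ((hV.differentiable one_ne_zero) z).hasFDerivAt.hasFDerivWithinAt)
    (fun z hz => by
      have := @hu (γ s) z (by rw [dist_comm]; exact hz) ⟨s, rfl⟩
      change dist (fderiv ℝ V (γ s)) (fderiv ℝ V z) < ε at this
      rw [dist_comm, dist_eq_norm] at this
      exact this.le) (Metric.mem_ball_self hδ) hs
  refine key.trans (mul_le_mul_of_nonneg_left ?_ hε.le)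
  exact (η - γ).norm_coe_le_norm s

lemma ContinuousMap.contDiff_comp_left {K F : Type*} [TopologicalSpace K] [CompactSpace K]
    [NormedAddCommGroup F] [NormedSpace ℝ F] {V : E → F} (hV : ContDiff ℝ 1 V) :
    ContDiff ℝ 1 (fun γ : C(K, E) => (⟨V, hV.continuous⟩ : C(E, F)).comp γ) := by
  refine contDiff_one_iff_hasFDerivAt.2 ⟨_, ?_, fun γ => ContinuousMap.hasFDerivAt_comp_left hV γ⟩
  exact ContinuousMap.clmApply.continuous.comp (ContinuousMap.continuous_postcomp _)

/-- The primitive of a continuous path. -/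
def pathIntegral [CompleteSpace E] : C(Set.Icc (0 : ℝ) 1, E) →L[ℝ] C(Set.Icc (0 : ℝ) 1, E) :=
  LinearMap.mkContinuous
    { toFun := fun η => ⟨fun s => ∫ r in (0 : ℝ)..s, η (Set.projIcc 0 1 zero_le_one r), by
        have : Continuous fun s : ℝ => ∫ r in (0 : ℝ)..s, η (Set.projIcc 0 1 zero_le_one r) :=
          intervalIntegral.continuous_primitive
            (fun a b => (η.continuous.comp continuous_projIcc).intervalIntegrable a b) 0
        exact this.comp continuous_subtype_val⟩
      map_add' := fun η θ => by
        ext s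
        exact intervalIntegral.integral_add
          ((η.continuous.comp continuous_projIcc).intervalIntegrable _ _)
          ((θ.continuous.comp continuous_projIcc).intervalIntegrable _ _)
      map_smul' := fun c η => by
        ext s
        exact intervalIntegral.integral_smul c _ } 1 (fun η => by
    rw [one_mul]
    refine (ContinuousMap.norm_le _ (by positivity)).2 fun s => ?_
    have := intervalIntegral.norm_integral_le_of_norm_le_const (a := 0) (b := s) (C := ‖η‖)
      (f := fun r => η (Set.projIcc 0 1 zero_le_one r)) (fun r _ => η.norm_coe_le_norm _)
    refine this.trans (mul_le_of_le_one_right (norm_nonneg _) ?_)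
    rw [sub_zero, abs_of_nonneg s.2.1]
    exact s.2.2)

lemma exists_forall_norm_le_of_continuousOn_Icc {E : Type*} [NormedAddCommGroup E] {a b : ℝ} {f : ℝ → E}
    (hf : ContinuousOn f (Set.Icc a b)) : ∃ R, ∀ t ∈ Set.Icc a b, f t ∈ Metric.closedBall 0 R := by
  obtain ⟨R, hR⟩ := isCompact_Icc.exists_bound_of_continuousOn hf
  exact ⟨R, fun t ht => by simpa using hR t ht⟩

variable (E) in
/-- The constant paths. -/
def constPath : E →L[ℝ] C(Set.Icc (0 : ℝ) 1, E) :=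
  LinearMap.mkContinuous
    { toFun := fun x => ContinuousMap.const _ x
      map_add' := fun _ _ => rfl
      map_smul' := fun _ _ => rfl } 1 (fun x => by
    rw [one_mul]
    exact (ContinuousMap.norm_le _ (by positivity)).2 fun s => le_rfl)

@[simp] lemma constPath_apply (x : E) (s : Set.Icc (0 : ℝ) 1) : constPath E x s = x := rfl

variable [FiniteDimensional ℝ E] {V : E → E}

lemma ContDiff.exists_lipschitzOnWith_closedBall (hV : ContDiff ℝ 1 V) (R : ℝ) :
    ∃ K, LipschitzOnWith K V (Metric.closedBall 0 R) :=
  hV.contDiffOn.exists_lipschitzOnWith one_ne_zero (convex_closedBall 0 R)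
    (isCompact_closedBall 0 R)

/-- Integral curves of a `C¹` vector field are unique. -/
lemma eqOn_Icc_of_integral_curves (hV : ContDiff ℝ 1 V) {a b : ℝ} {f g : ℝ → E}
    (hf : ContinuousOn f (Set.Icc a b))
    (hf' : ∀ t ∈ Set.Ico a b, HasDerivWithinAt f (V (f t)) (Set.Ici t) t)
    (hg : ContinuousOn g (Set.Icc a b))
    (hg' : ∀ t ∈ Set.Ico a b, HasDerivWithinAt g (V (g t)) (Set.Ici t) t)
    (h : f a = g a) : Set.EqOn f g (Set.Icc a b) := by
  -- `V` is Lipschitz only on bounded sets, so uniqueness is applied in a ball that contains both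
  -- curves.
  obtain ⟨R, hR⟩ := exists_forall_norm_le_of_continuousOn_Icc hf
  obtain ⟨R', hR'⟩ := exists_forall_norm_le_of_continuousOn_Icc hg
  obtain ⟨K, hK⟩ := hV.exists_lipschitzOnWith_closedBall (max R R')
  exact ODE_solution_unique_of_mem_Icc_right (v := fun _ => V)
    (s := fun _ => Metric.closedBall 0 (max R R')) (fun _ _ => hK) hf hf'
    (fun t ht => Metric.closedBall_subset_closedBall (le_max_left _ _)
      (hR t (Set.Ico_subset_Icc_self ht))) hg hg'
    (fun t ht => Metric.closedBall_subset_closedBall (le_max_right _ _)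
      (hR' t (Set.Ico_subset_Icc_self ht))) h

lemma eq_of_integral_curves (hV : ContDiff ℝ 1 V) {f g : ℝ → E}
    (hf : ∀ t, HasDerivAt f (V (f t)) t) (hg : ∀ t, HasDerivAt g (V (g t)) t)
    (h : f 0 = g 0) : f = g := by
  have aux : ∀ {V : E → E}, ContDiff ℝ 1 V → ∀ {f g : ℝ → E},
      (∀ t, HasDerivAt f (V (f t)) t) → (∀ t, HasDerivAt g (V (g t)) t) → f 0 = g 0 →
      ∀ t, 0 ≤ t → f t = g t := fun hV f g hf hg h t ht =>
    eqOn_Icc_of_integral_curves hV (fun s _ => (hf s).continuousAt.continuousWithinAt)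
      (fun s _ => (hf s).hasDerivWithinAt) (fun s _ => (hg s).continuousAt.continuousWithinAt)
      (fun s _ => (hg s).hasDerivWithinAt) h ⟨ht, le_rfl⟩
  funext t
  rcases le_total 0 t with ht | ht
  · exact aux hV hf hg h t ht
  -- Reversing time turns the curves into integral curves of `-V`.
  · have key : ∀ f : ℝ → E, (∀ t, HasDerivAt f (V (f t)) t) →
        ∀ t, HasDerivAt (fun t => f (-t)) (-V (f (-t))) t := fun f hf t => by
      simpa [Function.comp_def] using (hf (-t)).scomp t (hasDerivAt_neg t)
    simpa using aux (V := fun x => -V x) hV.neg (key f hf) (key g hg) (by simpa using h) (-t)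
      (by linarith)

/-- `θ` is the global flow of the vector field `V`. -/
structure IsGlobalFlow (V : E → E) (θ : ℝ → E → E) : Prop where
  zero : ∀ x, θ 0 x = x
  deriv : ∀ t x, HasDerivAt (fun t => θ t x) (V (θ t x)) t

namespace IsGlobalFlow
variable {θ : ℝ → E → E}

lemma add (h : IsGlobalFlow V θ) (hV : ContDiff ℝ 1 V) (s t : ℝ) (x : E) :
    θ (s + t) x = θ s (θ t x) := by
  have := eq_of_integral_curves hV (f := fun s => θ (s + t) x) (g := fun s => θ s (θ t x))
    (fun s => (h.deriv (s + t) x).comp_add_const s t) (fun s => h.deriv s _)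
    (by simp [h.zero])
  exact congrFun this s

lemma neg_cancel (h : IsGlobalFlow V θ) (hV : ContDiff ℝ 1 V) (t : ℝ) (x : E) :
    θ (-t) (θ t x) = x := by rw [← h.add hV, neg_add_cancel, h.zero]

/-- The operator whose zeros are the integral curves, with time rescaled to the unit interval. -/
def curveOperator (hV : ContDiff ℝ 1 V) (u : (ℝ × E) × C(Set.Icc (0 : ℝ) 1, E)) :
    C(Set.Icc (0 : ℝ) 1, E) :=
  u.2 - constPath E u.1.2 -
    u.1.1 • pathIntegral ((⟨V, hV.continuous⟩ : C(E, E)).comp u.2)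

lemma contDiff_curveOperator (hV : ContDiff ℝ 1 V) : ContDiff ℝ 1 (curveOperator hV) := by
  have := (ContinuousMap.contDiff_comp_left (K := Set.Icc (0 : ℝ) 1) hV).comp
    (contDiff_snd (E := ℝ × E))
  have h2 := (pathIntegral (E := E)).contDiff.comp this
  exact (contDiff_snd.sub ((constPath E).contDiff.comp (contDiff_snd.comp contDiff_fst))).sub
    ((contDiff_fst.comp contDiff_fst).smul h2)

/-- At time parameter 0 the integral term is switched off and the operator is a translation in the
path variable. This supplies the invertibility for the implicit function theorem. -/
lemma fderiv_curveOperator_inr (hV : ContDiff ℝ 1 V) (x : E) :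
    (fderiv ℝ (curveOperator hV) ((0, x), constPath E x)).comp
      (ContinuousLinearMap.inr ℝ (ℝ × E) C(Set.Icc (0 : ℝ) 1, E)) =
      ContinuousLinearMap.id ℝ _ := by
  have h1 := ((contDiff_curveOperator hV).differentiable one_ne_zero
    ((0, x), constPath E x)).hasFDerivAt
  have h2 : HasFDerivAt (fun γ : C(Set.Icc (0 : ℝ) 1, E) => (((0 : ℝ), x), γ))
      (ContinuousLinearMap.inr ℝ (ℝ × E) C(Set.Icc (0 : ℝ) 1, E)) (constPath E x) :=
    hasFDerivAt_prodMk_right _ _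
  have h3 := h1.comp (constPath E x) h2
  have h4 : curveOperator hV ∘ (fun γ : C(Set.Icc (0 : ℝ) 1, E) => (((0 : ℝ), x), γ)) =
      fun γ => γ - constPath E x := by
    funext γ
    simp [curveOperator]
  rw [h4] at h3
  exact h3.unique ((hasFDerivAt_id _).sub_const _)

/-- A zero satisfies γ(s) = x + t ∫₀ˢ V(γ), so it is an integral curve of `t • V`. So is s ↦ θ(ts,
x), and uniqueness identifies the two at s = 1. -/
lemma apply_one_of_curveOperator_eq_zero (h : IsGlobalFlow V θ) (hV : ContDiff ℝ 1 V)
    {u : (ℝ × E) × C(Set.Icc (0 : ℝ) 1, E)} (hu : curveOperator hV u = 0) :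
    u.2 1 = θ u.1.1 u.1.2 := by
  obtain ⟨⟨t, x⟩, γ⟩ := u
  let f : ℝ → E := fun s => x + t • ∫ r in (0 : ℝ)..s, V (γ (Set.projIcc 0 1 zero_le_one r))
  have hcont : Continuous fun r : ℝ => V (γ (Set.projIcc 0 1 zero_le_one r)) :=
    hV.continuous.comp (γ.continuous.comp continuous_projIcc)
  have hf : ∀ s, HasDerivAt f (t • V (γ (Set.projIcc 0 1 zero_le_one s))) s := fun s =>
    ((intervalIntegral.integral_hasDerivAt_right (hcont.intervalIntegrable _ _)
      hcont.stronglyMeasurable.stronglyMeasurableAtFilter hcont.continuousAt).const_smul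
        t).const_add x
  have hγ : ∀ s : Set.Icc (0 : ℝ) 1, γ s = f s := fun s => by
    have := congrArg (fun η : C(Set.Icc (0 : ℝ) 1, E) => η s) hu
    simp only [curveOperator, ContinuousMap.sub_apply, ContinuousMap.zero_apply, sub_eq_zero,
      sub_sub] at this
    exact this
  have hfg := eqOn_Icc_of_integral_curves (V := fun y => t • V y) (contDiff_const.smul hV)
    (a := 0) (b := 1) (f := f) (g := fun s => θ (t * s) x)
    (fun s _ => (hf s).continuousAt.continuousWithinAt)
    (fun s hs => by
      have := hf s
      rw [Set.projIcc_of_mem zero_le_one (Set.Ico_subset_Icc_self hs), hγ] at this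
      exact this.hasDerivWithinAt)
    (fun s _ => by
      have := (h.deriv (t * s) x).scomp s ((hasDerivAt_id s).const_mul t)
      exact this.continuousAt.continuousWithinAt)
    (fun s _ => by
      have := (h.deriv (t * s) x).scomp s ((hasDerivAt_id s).const_mul t)
      rw [mul_one] at this
      exact this.hasDerivWithinAt)
    (by simp [f, h.zero])
  have := hfg (Set.right_mem_Icc.2 zero_le_one)
  simp only [mul_one] at this
  rw [← this]
  exact hγ 1

/-- The implicit function theorem at the constant path yields zeros of `curveOperator` that depend
in a C¹ way on time and initial point; evaluation at 1 is continuous and linear. -/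
lemma contDiffAt_zero (h : IsGlobalFlow V θ) (hV : ContDiff ℝ 1 V) (x : E) :
    ContDiffAt ℝ 1 (fun u : ℝ × E => θ u.1 u.2) (0, x) := by
  have cdf : ContDiffAt ℝ 1 (curveOperator hV) ((0, x), constPath E x) :=
    (contDiff_curveOperator hV).contDiffAt
  have inv : ((fderiv ℝ (curveOperator hV) ((0, x), constPath E x)).comp
      (ContinuousLinearMap.inr ℝ (ℝ × E) C(Set.Icc (0 : ℝ) 1, E))).IsInvertible := by
    rw [fderiv_curveOperator_inr]
    exact ⟨ContinuousLinearEquiv.refl ℝ _, rfl⟩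
  have h0 : curveOperator hV ((0, x), constPath E x) = 0 := by
    simp [curveOperator]
  have h1 := cdf.contDiffAt_implicitFunction one_ne_zero inv
  have h2 := cdf.eventually_apply_implicitFunction one_ne_zero inv
  refine (((ContinuousMap.evalCLM ℝ (1 : Set.Icc (0 : ℝ) 1)).contDiff.contDiffAt).comp _
    h1).congr_of_eventuallyEq ?_
  filter_upwards [h2] with u hu
  exact (apply_one_of_curveOperator_eq_zero h hV (hu.trans h0)).symm

/-- Local smoothness at time 0 is propagated by the group property: the set of times `T` at which `θ
T` is C¹ at `x` is clopen and contains 0. -/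
lemma contDiff_apply (h : IsGlobalFlow V θ) (hV : ContDiff ℝ 1 V) (t : ℝ) :
    ContDiff ℝ 1 (θ t) := by
  refine contDiff_iff_contDiffAt.2 fun x => ?_
  have near : ∀ T : ℝ, ∃ ε > 0, ∀ T', |T' - T| < ε →
      (ContDiffAt ℝ 1 (θ T) x ↔ ContDiffAt ℝ 1 (θ T') x) := by
    intro T
    have h0 := (h.contDiffAt_zero hV (θ T x)).eventually (by simp)
    -- Passing from `S` back to `T` uses the base point `θ S x` and gives closedness; passing from
    -- `T` to `S` uses `θ T x` and gives openness.
    have hc : ContinuousAt (fun S => ((T - S, θ S x), (S - T, θ T x)) : ℝ → (ℝ × E) × (ℝ × E)) T :=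
      (((continuous_const.sub continuous_id).continuousAt).prodMk
        (h.deriv T x).continuousAt).prodMk
        (((continuous_id.sub continuous_const).continuousAt).prodMk continuousAt_const)
    have hev : ∀ᶠ S in nhds T, ContDiffAt ℝ 1 (fun u : ℝ × E => θ u.1 u.2) (T - S, θ S x) ∧
        ContDiffAt ℝ 1 (fun u : ℝ × E => θ u.1 u.2) (S - T, θ T x) := by
      have h1 := hc.fst.eventually (p := fun u => ContDiffAt ℝ 1 (fun u : ℝ × E => θ u.1 u.2) u)
        (by simpa using h0)
      have h2 := hc.snd.eventually (p := fun u => ContDiffAt ℝ 1 (fun u : ℝ × E => θ u.1 u.2) u)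
        (by simpa using h0)
      exact h1.and h2
    obtain ⟨ε, hε, hS⟩ := Metric.eventually_nhds_iff.1 hev
    have step : ∀ S S', ContDiffAt ℝ 1 (fun u : ℝ × E => θ u.1 u.2) (S' - S, θ S x) →
        ContDiffAt ℝ 1 (θ S) x → ContDiffAt ℝ 1 (θ S') x := by
      intro S S' h1 h2
      have h3 : ContDiffAt ℝ 1 (fun y => (S' - S, θ S y)) x := contDiffAt_const.prodMk h2
      have h4 : θ S' = fun y => θ (S' - S) (θ S y) := by
        funext y
        rw [← h.add hV, sub_add_cancel]
      rw [h4]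
      exact ContDiffAt.comp x (g := fun u : ℝ × E => θ u.1 u.2) h1 h3
    refine ⟨ε, hε, fun T' hT' => ?_⟩
    have := hS (y := T') (by simpa [Real.dist_eq] using hT')
    exact ⟨step _ _ this.2, step _ _ this.1⟩
  have hclopen : IsClopen {T | ContDiffAt ℝ 1 (θ T) x} := by
    constructor
    · rw [← isOpen_compl_iff, Metric.isOpen_iff]
      intro T hT
      obtain ⟨ε, hε, hn⟩ := near T
      exact ⟨ε, hε, fun T' hT' hc => hT ((hn T' (by simpa [Real.dist_eq] using hT')).2 hc)⟩
    · rw [Metric.isOpen_iff]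
      intro T hT
      obtain ⟨ε, hε, hn⟩ := near T
      exact ⟨ε, hε, fun T' hT' => (hn T' (by simpa [Real.dist_eq] using hT')).1 hT⟩
  have huniv := hclopen.eq_univ ⟨0, by
    have : θ 0 = id := funext h.zero
    simp only [Set.mem_ofPred_eq, this]
    exact contDiffAt_id⟩
  have : t ∈ {T | ContDiffAt ℝ 1 (θ T) x} := huniv ▸ Set.mem_univ t
  exact this

/-- The global flow of a `C¹` vector field is jointly `C¹` in time and initial point. -/
theorem contDiff (h : IsGlobalFlow V θ) (hV : ContDiff ℝ 1 V) :
    ContDiff ℝ 1 (fun u : ℝ × E => θ u.1 u.2) := by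
  refine contDiff_iff_contDiffAt.2 fun ⟨t, x⟩ => ?_
  have h1 : (fun u : ℝ × E => θ u.1 u.2) =
      (fun u : ℝ × E => θ u.1 u.2) ∘ (fun u : ℝ × E => (u.1 - t, θ t u.2)) := by
    funext u
    simp [← h.add hV]
  rw [h1]
  refine ContDiffAt.comp _ (by simpa using h.contDiffAt_zero hV (θ t x)) ?_
  exact ((contDiff_fst.sub contDiff_const).prodMk
    ((h.contDiff_apply hV t).comp contDiff_snd)).contDiffAt

end IsGlobalFlow
end ODE

/-! ### Functions transported by a flow, and their time derivatives in norm -/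

section Transport
variable {E : Type*} [NormedAddCommGroup E] [NormedSpace ℝ E] [FiniteDimensional ℝ E]
  {V : E → E} {θ : ℝ → E → E}

namespace IsGlobalFlow

/-- Splitting `θ s` as `θ t` after `θ (s - t)` puts the field at the fixed point `x` and the
derivative on the transported function. This is the form in which the Liouville equation is written.
-/
lemma hasDerivAt_comp (h : IsGlobalFlow V θ) (hV : ContDiff ℝ 1 V) {f : E → ℝ}
    (hf : ContDiff ℝ 1 f) (t : ℝ) (x : E) :
    HasDerivAt (fun s => f (θ s x)) (fderiv ℝ (fun y => f (θ t y)) x (V x)) t := by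
  have hg : ContDiff ℝ 1 (fun y => f (θ t y)) := hf.comp (h.contDiff_apply hV t)
  have h1 : HasFDerivAt (fun y => f (θ t y)) (fderiv ℝ (fun y => f (θ t y)) x) (θ 0 x) := by
    rw [h.zero]
    exact (hg.differentiable one_ne_zero x).hasFDerivAt
  have h2 := h1.comp_hasDerivAt (0 : ℝ) (h.deriv 0 x)
  rw [h.zero] at h2
  have h3 : (fun s => f (θ s x)) = fun s => ((fun y => f (θ t y)) ∘ fun t => θ t x) (s - t) := by
    funext s
    simp [← h.add hV]
  rw [h3]
  refine HasDerivAt.comp_sub_const t t ?_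
  rwa [sub_self]

lemma hasDerivAt_comp_neg (h : IsGlobalFlow V θ) (hV : ContDiff ℝ 1 V) {f : E → ℝ}
    (hf : ContDiff ℝ 1 f) (t : ℝ) (x : E) :
    HasDerivAt (fun s => f (θ (-s) x)) (-fderiv ℝ (fun y => f (θ (-t) y)) x (V x)) t := by
  simpa [Function.comp_def] using (h.hasDerivAt_comp hV hf (-t) x).scomp t (hasDerivAt_neg t)

end IsGlobalFlow

/-- The functions `h t` vanish outside a compact set which is locally independent of `t`. -/
def LocallyUniformCompactSupport (h : ℝ → E → ℝ) : Prop :=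
  ∀ R, ∃ K : Set E, IsCompact K ∧ ∀ t, |t| ≤ R → ∀ x ∉ K, h t x = 0

omit [NormedSpace ℝ E] [FiniteDimensional ℝ E] in
lemma LocallyUniformCompactSupport.hasCompactSupport {h : ℝ → E → ℝ}
    (hh : LocallyUniformCompactSupport h) (t : ℝ) : HasCompactSupport (h t) := by
  obtain ⟨K, hK, hK'⟩ := hh |t|
  exact HasCompactSupport.intro hK fun x hx => hK' t le_rfl x hx

omit [NormedSpace ℝ E] [FiniteDimensional ℝ E] in
lemma LocallyUniformCompactSupport.sum {ι : Type*} {s : Finset ι} {h : ι → ℝ → E → ℝ}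
    (hh : ∀ i ∈ s, LocallyUniformCompactSupport (h i)) :
    LocallyUniformCompactSupport (fun t x => ∑ i ∈ s, h i t x) := by
  intro R
  choose! K hK hK' using fun i hi => hh i hi R
  refine ⟨⋃ i ∈ s, K i, s.isCompact_biUnion hK, fun t ht x hx => ?_⟩
  refine Finset.sum_eq_zero fun i hi => hK' i hi t ht x fun hxi => hx ?_
  exact Set.mem_biUnion (by simpa using hi) hxi

omit [NormedSpace ℝ E] [FiniteDimensional ℝ E] in
lemma LocallyUniformCompactSupport.const_mul {h : ℝ → E → ℝ}
    (hh : LocallyUniformCompactSupport h) (c : ℝ) :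
    LocallyUniformCompactSupport (fun t x => c * h t x) := by
  intro R
  obtain ⟨K, hK, hK'⟩ := hh R
  exact ⟨K, hK, fun t ht x hx => by simp [hK' t ht x hx]⟩

/-- A point where the transported function is nonzero is reached from the support of `f` in time
`-t`, so it lies in the image of a compact set under the jointly continuous flow. -/
lemma IsGlobalFlow.locallyUniformCompactSupport (h : IsGlobalFlow V θ) (hV : ContDiff ℝ 1 V)
    {f : E → ℝ} (hf : HasCompactSupport f) :
    LocallyUniformCompactSupport (fun t x => f (θ t x)) := by
  intro R
  refine ⟨(fun u : ℝ × E => θ u.1 u.2) '' (Set.Icc (-R) R ×ˢ tsupport f),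
    (isCompact_Icc.prod hf).image (h.contDiff hV).continuous, fun t ht x hx => ?_⟩
  by_contra hne
  refine hx ⟨(-t, θ t x), ⟨?_, subset_tsupport _ hne⟩, h.neg_cancel hV t x⟩
  constructor <;> linarith [abs_le.1 ht]

omit [FiniteDimensional ℝ E] in
lemma hasDerivAt_slice {h : ℝ → E → ℝ} (hh : ContDiff ℝ 1 (fun u : ℝ × E => h u.1 u.2)) (t : ℝ)
    (x : E) : HasDerivAt (fun s => h s x)
      (fderiv ℝ (fun u : ℝ × E => h u.1 u.2) (t, x) (1, 0)) t := by
  have h1 := (hh.differentiable one_ne_zero (t, x)).hasFDerivAt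
  exact h1.comp_hasDerivAt t ((hasDerivAt_id t).prodMk (hasDerivAt_const t x))

omit [FiniteDimensional ℝ E] in
lemma continuous_of_hasDerivAt_slice {h : ℝ → E → ℝ}
    (hh : ContDiff ℝ 1 (fun u : ℝ × E => h u.1 u.2)) {h' : ℝ → E → ℝ}
    (hd : ∀ t x, HasDerivAt (fun s => h s x) (h' t x) t) :
    Continuous (fun u : ℝ × E => h' u.1 u.2) := by
  have : (fun u : ℝ × E => h' u.1 u.2) =
      fun u => fderiv ℝ (fun u : ℝ × E => h u.1 u.2) u (1, 0) := by
    funext u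
    exact (hd u.1 u.2).unique (hasDerivAt_slice hh u.1 u.2)
  rw [this]
  exact (hh.continuous_fderiv one_ne_zero).clm_apply continuous_const

omit [NormedSpace ℝ E] [FiniteDimensional ℝ E] in
lemma LocallyUniformCompactSupport.of_hasDerivAt {h h' : ℝ → E → ℝ}
    (hs : LocallyUniformCompactSupport h)
    (hd : ∀ t x, HasDerivAt (fun s => h s x) (h' t x) t) : LocallyUniformCompactSupport h' := by
  intro R
  -- One unit of room, so that `h s x` vanishes for all `s` near `t`.
  obtain ⟨K, hK, hK'⟩ := hs (R + 1)
  refine ⟨K, hK, fun t ht x hx => (hd t x).unique ?_⟩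
  refine (hasDerivAt_const t 0).congr_of_eventuallyEq ?_
  filter_upwards [Metric.ball_mem_nhds t one_pos] with s hs
  refine hK' s ?_ x hx
  rw [Metric.mem_ball, Real.dist_eq] at hs
  have := abs_sub_abs_le_abs_sub s t
  linarith

omit [FiniteDimensional ℝ E] in
/-- A jointly `C¹` function with locally uniform compact support is differentiable in the first
variable uniformly in the second one. -/
lemma exists_uniform_slope_bound {h h' : ℝ → E → ℝ}
    (hh : ContDiff ℝ 1 (fun u : ℝ × E => h u.1 u.2)) (hs : LocallyUniformCompactSupport h)
    (hd : ∀ t x, HasDerivAt (fun s => h s x) (h' t x) t) (t : ℝ) :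
    ∃ K : Set E, IsCompact K ∧ ∀ ε > 0, ∃ δ > 0, ∀ s, |s - t| < δ → ∀ x,
      ‖h s x - h t x - (s - t) * h' t x‖ ≤ K.indicator (fun _ => ε * |s - t|) x := by
  obtain ⟨K, hK, hK0⟩ := hs (|t| + 1)
  obtain ⟨K', hK', hK0'⟩ := (hs.of_hasDerivAt hd) (|t| + 1)
  -- The compact set is fixed before `ε`, so one estimate serves both the uniform norm and, after
  -- integrating the indicator, the `L¹` norm.
  refine ⟨K ∪ K', hK.union hK', fun ε hε => ?_⟩
  have hc : IsCompact ({t} ×ˢ (K ∪ K')) := isCompact_singleton.prod (hK.union hK')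
  have hu := hc.uniformContinuousAt_of_continuousAt (fun u : ℝ × E => h' u.1 u.2)
    (fun a _ => (continuous_of_hasDerivAt_slice hh hd).continuousAt) (Metric.dist_mem_uniformity hε)
  obtain ⟨δ, hδ, hu⟩ := Metric.mem_uniformity_dist.1 hu
  refine ⟨min δ 1, lt_min hδ one_pos, fun s hst x => ?_⟩
  by_cases hx : x ∈ K ∪ K'
  · rw [Set.indicator_of_mem hx]
    have key := (convex_ball t δ).norm_image_sub_le_of_norm_hasDerivWithin_le
      (f := fun s => h s x - (s - t) * h' t x) (f' := fun s => h' s x - h' t x) (C := ε)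
      (x := t) (y := s)
      (fun r _ => by
        have h1 := (hd r x).sub (((hasDerivAt_id r).sub_const t).mul_const (h' t x))
        rw [one_mul] at h1
        exact h1.hasDerivWithinAt)
      (fun r hr => by
        have h1 : dist ((t, x) : ℝ × E) (r, x) < δ := by
          rw [Prod.dist_eq, dist_self, max_eq_left dist_nonneg, dist_comm]
          exact hr
        have h2 := hu h1 ⟨rfl, hx⟩
        change dist (h' t x) (h' r x) < ε at h2
        rw [dist_comm, Real.dist_eq] at h2
        exact h2.le)
      (Metric.mem_ball_self hδ)
      (by rw [Metric.mem_ball, Real.dist_eq]; exact hst.trans_le (min_le_left _ _))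
    have e : h s x - h t x - (s - t) * h' t x = 
        h s x - (s - t) * h' t x - (h t x - (t - t) * h' t x) := by ring
    rw [e]
    exact key
  · rw [Set.indicator_of_notMem hx]
    rw [Set.mem_union, not_or] at hx
    have h1 : |s| ≤ |t| + 1 := by
      have := abs_sub_abs_le_abs_sub s t
      have := hst.trans_le (min_le_right _ _)
      linarith
    simp [hK0 s h1 x hx.1, hK0 t (by linarith) x hx.1, hK0' t (by linarith) x hx.2]

omit [FiniteDimensional ℝ E] in
/-- The derivative in the uniform norm. -/
lemma hasDerivAt_boundedContinuousFunction {h h' : ℝ → E → ℝ}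
    (hh : ContDiff ℝ 1 (fun u : ℝ × E => h u.1 u.2)) (hs : LocallyUniformCompactSupport h)
    (hd : ∀ t x, HasDerivAt (fun s => h s x) (h' t x) t)
    {u : ℝ → BoundedContinuousFunction E ℝ} {v : BoundedContinuousFunction E ℝ} {t : ℝ}
    (hu : ∀ s x, u s x = h s x) (hv : ∀ x, v x = h' t x) : HasDerivAt u v t := by
  obtain ⟨K, hK, hKε⟩ := exists_uniform_slope_bound hh hs hd t
  refine hasDerivAt_iff_isLittleO.2 (Asymptotics.isLittleO_iff.2 fun ε hε => ?_)
  obtain ⟨δ, hδ, hδ'⟩ := hKε ε hε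
  filter_upwards [Metric.ball_mem_nhds t hδ] with s hs
  refine (BoundedContinuousFunction.norm_le (by positivity)).2 fun x => ?_
  have h1 := hδ' s (by simpa [Real.dist_eq] using hs) x
  simp only [BoundedContinuousFunction.coe_sub, Pi.sub_apply, hu,
    BoundedContinuousFunction.coe_smul, hv, smul_eq_mul]
  exact h1.trans (Set.indicator_le_self' (fun _ _ => by positivity) x)

variable [MeasurableSpace E] [BorelSpace E] {μ : Measure E} [IsFiniteMeasureOnCompacts μ]

omit [FiniteDimensional ℝ E] in
/-- The derivative in the `L¹` norm. -/
lemma hasDerivAt_L1 {h h' : ℝ → E → ℝ}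
    (hh : ContDiff ℝ 1 (fun u : ℝ × E => h u.1 u.2)) (hs : LocallyUniformCompactSupport h)
    (hd : ∀ t x, HasDerivAt (fun s => h s x) (h' t x) t)
    {u : ℝ → Lp ℝ 1 μ} {v : Lp ℝ 1 μ} {t : ℝ}
    (hu : ∀ s, u s =ᵐ[μ] h s) (hv : v =ᵐ[μ] h' t) : HasDerivAt u v t := by
  obtain ⟨K, hK, hKε⟩ := exists_uniform_slope_bound hh hs hd t
  refine hasDerivAt_iff_isLittleO.2 (Asymptotics.isLittleO_iff.2 fun ε hε => ?_)
  -- The summand 1 keeps the divisor positive when `K` is null.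
  have hm : 0 < μ.real K + 1 := by positivity
  obtain ⟨δ, hδ, hδ'⟩ := hKε (ε / (μ.real K + 1)) (div_pos hε hm)
  filter_upwards [Metric.ball_mem_nhds t hδ] with s hs
  rw [Metric.mem_ball, Real.dist_eq] at hs
  rw [L1.norm_eq_integral_norm]
  have h1 : ∫ x, ‖(u s - u t - (s - t) • v) x‖ ∂μ ≤
      ∫ x, K.indicator (fun _ => ε / (μ.real K + 1) * |s - t|) x ∂μ := by
    refine integral_mono_ae (L1.integrable_coeFn _).norm
      ((integrable_indicator_iff hK.measurableSet).2
        (integrableOn_const hK.measure_lt_top.ne)) ?_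
    filter_upwards [hu s, hu t, hv, Lp.coeFn_sub (u s - u t) ((s - t) • v),
      Lp.coeFn_sub (u s) (u t), Lp.coeFn_smul (s - t) v] with x h1 h2 h3 h4 h5 h6
    rw [h4, Pi.sub_apply, h5, Pi.sub_apply, h6, Pi.smul_apply, h1, h2, h3]
    exact hδ' s hs x
  refine h1.trans ?_
  rw [integral_indicator hK.measurableSet, setIntegral_const, smul_eq_mul, Real.norm_eq_abs,
    ← mul_assoc]
  refine mul_le_mul_of_nonneg_right ?_ (abs_nonneg _)
  rw [mul_div_assoc', div_le_iff₀ hm]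
  nlinarith [measureReal_nonneg (μ := μ) (s := K)]

end Transport

/-! ### Weakly divergence free fields and Liouville's theorem -/

section DivergenceFree
variable {E : Type*} [NormedAddCommGroup E] [NormedSpace ℝ E] [FiniteDimensional ℝ E]
  [MeasurableSpace E] [BorelSpace E] {μ : Measure E} {V : E → E} {θ : ℝ → E → E}

/-- A continuous vector field whose divergence vanishes in the sense of distributions. -/
structure IsDivergenceFree (μ : Measure E) (V : E → E) : Prop where
  continuous : Continuous V
  integral_fderiv : ∀ f : E → ℝ, ContDiff ℝ 1 f → HasCompactSupport f →
    ∫ x, fderiv ℝ f x (V x) ∂μ = 0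

omit [FiniteDimensional ℝ E] [MeasurableSpace E] [BorelSpace E] in
lemma continuous_fderiv_field (hV : Continuous V) {f : E → ℝ} (hf : ContDiff ℝ 1 f) :
    Continuous (fun x => fderiv ℝ f x (V x)) :=
  (hf.continuous_fderiv one_ne_zero).clm_apply hV

omit [FiniteDimensional ℝ E] [MeasurableSpace E] [BorelSpace E] in
lemma hasCompactSupport_fderiv_field {f : E → ℝ} (hf : HasCompactSupport f) :
    HasCompactSupport (fun x => fderiv ℝ f x (V x)) :=
  (hf.fderiv ℝ).mono (fun x hx h => hx (by simp [h]))

omit [FiniteDimensional ℝ E] in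
lemma integrable_fderiv_field [IsFiniteMeasureOnCompacts μ] (hV : Continuous V) {f : E → ℝ}
    (hf : ContDiff ℝ 1 f) (hs : HasCompactSupport f) :
    Integrable (fun x => fderiv ℝ f x (V x)) μ :=
  (continuous_fderiv_field hV hf).integrable_of_hasCompactSupport
    (hasCompactSupport_fderiv_field hs)

namespace IsDivergenceFree

omit [FiniteDimensional ℝ E] in
lemma sum [IsFiniteMeasureOnCompacts μ] {ι : Type*} {s : Finset ι} {W : ι → E → E}
    (h : ∀ i ∈ s, IsDivergenceFree μ (W i)) :
    IsDivergenceFree μ (fun x => ∑ i ∈ s, W i x) where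
  continuous := continuous_finsetSum _ fun i hi => (h i hi).continuous
  integral_fderiv f hf hs := by
    simp_rw [map_sum]
    rw [integral_finsetSum _ fun i hi => integrable_fderiv_field (h i hi).continuous hf hs]
    exact Finset.sum_eq_zero fun i hi => (h i hi).integral_fderiv f hf hs

/-- Integration by parts along `e` moves the derivative onto `c`, which is constant in that
direction. -/
lemma smul_const [μ.IsAddHaarMeasure] {c : E → ℝ} {e : E} (hc : Continuous c)
    (hce : ∀ x (t : ℝ), c (x + t • e) = c x) : IsDivergenceFree μ (fun x => c x • e) where
  continuous := hc.smul continuous_const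
  integral_fderiv f hf hs := by
    have h := integral_bilinear_hasLineDerivAt_right_eq_neg_left_of_integrable (μ := μ) (v := e)
      (B := ContinuousLinearMap.mul ℝ ℝ) (f := c) (f' := fun _ => 0) (g := f)
      (g' := fun x => fderiv ℝ f x e) (by simp)
      ((hc.mul ((hf.continuous_fderiv one_ne_zero).clm_apply
        continuous_const)).integrable_of_hasCompactSupport
          (HasCompactSupport.mul_left (hasCompactSupport_fderiv_field (V := fun _ => e) hs)))
      ((hc.mul hf.continuous).integrable_of_hasCompactSupport hs.mul_left)
      (fun x _ => by
        simp only [HasLineDerivAt, hce]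
        exact hasDerivAt_const _ _)
      (fun x _ => (hf.differentiable one_ne_zero x).hasFDerivAt.hasLineDerivAt e)
    simpa using h

omit [FiniteDimensional ℝ E] in
-- Skew-adjointness follows from the vanishing integral for the product of `f` and `ψ`; compact
-- support of one factor suffices.
lemma integral_fderiv_mul [IsFiniteMeasureOnCompacts μ] (h : IsDivergenceFree μ V) {f ψ : E → ℝ}
    (hf : ContDiff ℝ 1 f) (hψ : ContDiff ℝ 1 ψ) (hs : HasCompactSupport ψ) :
    ∫ x, fderiv ℝ f x (V x) * ψ x ∂μ = -∫ x, f x * fderiv ℝ ψ x (V x) ∂μ := by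
  have h1 := h.integral_fderiv (fun x => f x * ψ x) (hf.mul hψ) hs.mul_left
  have h2 : ∀ x, fderiv ℝ (fun x => f x * ψ x) x (V x) =
      f x * fderiv ℝ ψ x (V x) + fderiv ℝ f x (V x) * ψ x := fun x => by
    rw [fderiv_fun_mul (hf.differentiable one_ne_zero x) (hψ.differentiable one_ne_zero x)]
    simp [mul_comm]
  simp_rw [h2] at h1
  have i1 : Integrable (fun x => f x * fderiv ℝ ψ x (V x)) μ :=
    (hf.continuous.mul (continuous_fderiv_field h.continuous hψ)).integrable_of_hasCompactSupport
      (hasCompactSupport_fderiv_field hs).mul_left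
  have i2 : Integrable (fun x => fderiv ℝ f x (V x) * ψ x) μ :=
    ((continuous_fderiv_field h.continuous hf).mul hψ.continuous).integrable_of_hasCompactSupport
      hs.mul_left
  rw [integral_add i1 i2] at h1
  linarith

end IsDivergenceFree

/-- Liouville's theorem: the flow of a divergence free field preserves integrals. -/
theorem IsGlobalFlow.integral_comp [IsFiniteMeasureOnCompacts μ] (h : IsGlobalFlow V θ)
    (hV : ContDiff ℝ 1 V) (hdiv : IsDivergenceFree μ V) {f : E → ℝ} (hf : ContDiff ℝ 1 f)
    (hs : HasCompactSupport f) (t : ℝ) : ∫ x, f (θ t x) ∂μ = ∫ x, f x ∂μ := by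
  have hh : ContDiff ℝ 1 (fun u : ℝ × E => f (θ u.1 u.2)) := hf.comp (h.contDiff hV)
  have hfs := h.locallyUniformCompactSupport hV hs
  have hfc : ∀ t, ContDiff ℝ 1 (fun x => f (θ t x)) := fun t => hf.comp (h.contDiff_apply hV t)
  have hint : ∀ t, Integrable (fun x => f (θ t x)) μ := fun t =>
    (hfc t).continuous.integrable_of_hasCompactSupport (hfs.hasCompactSupport t)
  have hint' : ∀ t, Integrable (fun x => fderiv ℝ (fun y => f (θ t y)) x (V x)) μ := fun t =>
    integrable_fderiv_field hdiv.continuous (hfc t) (hfs.hasCompactSupport t)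
  -- The transported function is again an admissible test function, so the integral of its
  -- derivative along `V` vanishes. No Jacobian of the flow is needed.
  have hder : ∀ t, HasDerivAt (fun t => ∫ x, f (θ t x) ∂μ) 0 t := by
    intro t
    have h1 := hasDerivAt_L1 (μ := μ) (h := fun t x => f (θ t x)) hh hfs
      (fun t x => h.hasDerivAt_comp hV hf t x)
      (u := fun t => (hint t).toL1) (v := (hint' t).toL1) (t := t)
      (fun s => (hint s).coeFn_toL1) (hint' t).coeFn_toL1
    have h2 := (L1.integralCLM (α := E) (E := ℝ) (μ := μ)).hasFDerivAt.comp_hasDerivAt t h1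
    have h3 : ∀ {g : E → ℝ} (hg : Integrable g μ),
        L1.integralCLM (α := E) (E := ℝ) (μ := μ) hg.toL1 = ∫ x, g x ∂μ := fun {g} hg => by
      rw [integral_eq g hg, L1.integral_eq]
    rw [h3, hdiv.integral_fderiv _ (hfc t) (hfs.hasCompactSupport t)] at h2
    have h4 : (L1.integralCLM (α := E) (E := ℝ) (μ := μ)) ∘ (fun t => (hint t).toL1) =
        fun t => ∫ x, f (θ t x) ∂μ := funext fun t => h3 _
    rwa [h4] at h2
  have := is_const_of_deriv_eq_zero (fun t => (hder t).differentiableAt)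
    (fun t => (hder t).deriv) t 0
  simpa [h.zero] using this

/-- The absolute value is not C¹. It is the limit of √(y² + ε²) - ε, which is smooth, vanishes at 0
(so compact support survives) and is dominated by |y|. -/
theorem IsGlobalFlow.integral_abs_comp [IsFiniteMeasureOnCompacts μ] (h : IsGlobalFlow V θ)
    (hV : ContDiff ℝ 1 V) (hdiv : IsDivergenceFree μ V) {f : E → ℝ} (hf : ContDiff ℝ 1 f)
    (hs : HasCompactSupport f) (t : ℝ) : ∫ x, |f (θ t x)| ∂μ = ∫ x, |f x| ∂μ := by
  let a : ℕ → ℝ → ℝ := fun n y => √(y ^ 2 + (1 / ((n : ℝ) + 1)) ^ 2) - 1 / ((n : ℝ) + 1)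
  have ha0 : ∀ n, a n 0 = 0 := fun n => by
    have : (0 : ℝ) ≤ 1 / ((n : ℝ) + 1) := by positivity
    simp only [a]
    rw [zero_pow two_ne_zero, zero_add, Real.sqrt_sq this, sub_self]
  have hac : ∀ n, ContDiff ℝ 1 (a n) := fun n => by
    refine ContDiff.sub (ContDiff.sqrt (by fun_prop) fun y => ?_) contDiff_const
    have : (0 : ℝ) < 1 / ((n : ℝ) + 1) := by positivity
    positivity
  have hale : ∀ n y, ‖a n y‖ ≤ |y| := fun n y => by
    have h0 : (0 : ℝ) ≤ 1 / ((n : ℝ) + 1) := by positivity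
    rw [Real.norm_eq_abs, abs_le]
    constructor
    · have : 1 / ((n : ℝ) + 1) ≤ √(y ^ 2 + (1 / ((n : ℝ) + 1)) ^ 2) :=
        Real.le_sqrt_of_sq_le (by nlinarith [sq_nonneg y])
      simp only [a]
      linarith [abs_nonneg y]
    · simp only [a]
      rw [sub_le_iff_le_add, Real.sqrt_le_left (by positivity)]
      nlinarith [sq_abs y, abs_nonneg y, mul_nonneg (abs_nonneg y) h0]
  have hat : ∀ y, Filter.Tendsto (fun n => a n y) Filter.atTop (nhds |y|) := fun y => by
    have h1 : Filter.Tendsto (fun n : ℕ => 1 / ((n : ℝ) + 1)) Filter.atTop (nhds 0) :=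
      tendsto_one_div_add_atTop_nhds_zero_nat
    have h2 := ((((h1.pow 2).const_add (y ^ 2)).sqrt).sub h1)
    simpa [a, Real.sqrt_sq_eq_abs] using h2
  have lim : ∀ {g : E → ℝ}, Continuous g → HasCompactSupport g →
      Filter.Tendsto (fun n => ∫ x, a n (g x) ∂μ) Filter.atTop (nhds (∫ x, |g x| ∂μ)) :=
    fun {g} hg hgs => tendsto_integral_of_dominated_convergence (fun x => |g x|)
      (fun n => ((hac n).continuous.comp hg).aestronglyMeasurable)
      (hg.integrable_of_hasCompactSupport hgs).abs (fun n => .of_forall fun x => hale n _)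
      (.of_forall fun x => hat _)
  refine tendsto_nhds_unique (lim (hf.continuous.comp (h.contDiff_apply hV t).continuous)
    ((h.locallyUniformCompactSupport hV hs).hasCompactSupport t)) ?_
  refine (lim hf.continuous hs).congr fun n => ?_
  exact (h.integral_comp hV hdiv (f := fun x => a n (f x)) ((hac n).comp hf)
    (hs.comp_left (ha0 n)) t).symm

end DivergenceFree

/-! ### Möbius inversion in the partition lattice -/

namespace Finpartition
variable {α : Type*} [DecidableEq α] {s : Finset α}

lemma part_subset_part {P Q : Finpartition s} (h : P ≤ Q) (a : α) : P.part a ⊆ Q.part a := by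
  by_cases ha : a ∈ s
  · obtain ⟨C, hC, hle⟩ := h (P.part_mem.2 ha)
    rw [Q.part_eq_of_mem hC (hle (P.mem_part_self.2 ha))]
    exact hle
  · rw [P.part_eq_empty.2 ha]
    exact Finset.empty_subset _

lemma part_eq_part_of_le {P Q : Finpartition s} (h : P ≤ Q) {a b : α} (ha : a ∈ s) (hb : b ∈ s)
    (hab : P.part a = P.part b) : Q.part a = Q.part b := by
  rw [← Q.mem_part_iff_part_eq_part ha hb]
  exact part_subset_part h b (hab ▸ P.mem_part_self.2 ha)

lemma le_of_part_eq_part {P Q : Finpartition s}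
    (h : ∀ a ∈ s, ∀ b ∈ s, P.part a = P.part b → Q.part a = Q.part b) : P ≤ Q := by
  intro B hB
  obtain ⟨a, ha⟩ := P.nonempty_of_mem_parts hB
  have has := P.subset hB ha
  refine ⟨Q.part a, Q.part_mem.2 has, fun b hb => ?_⟩
  have hbs := P.subset hB hb
  rw [Q.mem_part_iff_part_eq_part hbs has]
  exact h b hbs a has (by rw [P.part_eq_of_mem hB hb, P.part_eq_of_mem hB ha])

lemma eq_of_part_eq_part_iff {P Q : Finpartition s}
    (h : ∀ a ∈ s, ∀ b ∈ s, P.part a = P.part b ↔ Q.part a = Q.part b) : P = Q :=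
  le_antisymm (le_of_part_eq_part fun a ha b hb => (h a ha b hb).1)
    (le_of_part_eq_part fun a ha b hb => (h a ha b hb).2)

/-- A point of a block. -/
def rep (P : Finpartition s) (B : P.parts) : α := (P.nonempty_of_mem_parts B.2).choose

lemma rep_mem (P : Finpartition s) (B : P.parts) : P.rep B ∈ B.1 :=
  (P.nonempty_of_mem_parts B.2).choose_spec

lemma rep_mem' (P : Finpartition s) (B : P.parts) : P.rep B ∈ s := P.subset B.2 (P.rep_mem B)

/-- The block of a point. -/
def block (P : Finpartition s) {a : α} (ha : a ∈ s) : P.parts := ⟨P.part a, P.part_mem.2 ha⟩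

lemma block_rep (P : Finpartition s) (B : P.parts) : P.block (P.rep_mem' B) = B :=
  Subtype.ext (P.part_eq_of_mem B.2 (P.rep_mem B))

lemma block_eq_block_iff (P : Finpartition s) {a b : α} (ha : a ∈ s) (hb : b ∈ s) :
    P.block ha = P.block hb ↔ P.part a = P.part b := Subtype.ext_iff

/-- An injective colouring of the blocks of a coarser partition colours the blocks of `P`. -/
def colouring (P : Finpartition s) {C : Type*} (x : Σ Q : {Q // P ≤ Q}, Q.1.parts ↪ C) :
    P.parts → C := fun B => x.2 (x.1.1.block (P.rep_mem' B))

lemma colouring_block (P : Finpartition s) {C : Type*} (x : Σ Q : {Q // P ≤ Q}, Q.1.parts ↪ C)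
    {a : α} (ha : a ∈ s) : P.colouring x (P.block ha) = x.2 (x.1.1.block ha) := by
  refine congrArg x.2 ((x.1.1.block_eq_block_iff _ _).2 (part_eq_part_of_le x.1.2 ?_ ha ?_))
  · exact P.rep_mem' _
  · rw [← P.block_eq_block_iff (P.rep_mem' _) ha, P.block_rep]

/-- A map on the blocks of `P` amounts to the coarsening of `P` formed by its fibres together with
an injective labelling of the coarser blocks. -/
lemma colouring_bijective (P : Finpartition s) (C : Type*) :
    Function.Bijective (P.colouring (C := C)) := by
  classical
  constructor
  · rintro ⟨⟨Q, hQ⟩, j⟩ ⟨⟨Q', hQ'⟩, j'⟩ h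
    have hb : ∀ a (ha : a ∈ s), j (Q.block ha) = j' (Q'.block ha) := fun a ha => by
      have := congrFun h (P.block ha)
      rwa [colouring_block, colouring_block] at this
    obtain rfl : Q = Q' := eq_of_part_eq_part_iff fun a ha b hb' => by
      rw [← block_eq_block_iff _ ha hb', ← block_eq_block_iff _ ha hb', ← j.injective.eq_iff,
        hb, hb, j'.injective.eq_iff]
    obtain rfl : j = j' := by
      ext B
      rw [← Q.block_rep B, hb]
    rfl
  · intro f
    let g : s → C := fun a => f (P.block a.2)
    -- The relation has to live on all of `α`; points outside `s` get the spare colour `none`.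
    let r : Setoid α :=
      Setoid.ker fun a => if h : a ∈ s then some (f (P.block h)) else none
    let Q : Finpartition s := ofSetSetoid r s
    have hQ : ∀ {a b} (ha : a ∈ s) (hb : b ∈ s),
        Q.part a = Q.part b ↔ f (P.block ha) = f (P.block hb) := fun {a b} ha hb => by
      rw [← Q.mem_part_iff_part_eq_part ha hb, mem_part_ofSetSetoid_iff_rel]
      simp only [r, Setoid.ker_def, ha, hb, true_and, dif_pos, Option.some_inj]
      exact eq_comm
    have hPQ : P ≤ Q := le_of_part_eq_part fun a ha b hb h =>
      (hQ ha hb).2 (congrArg f ((P.block_eq_block_iff ha hb).2 h))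
    refine ⟨⟨⟨Q, hPQ⟩, ⟨fun B => f (P.block (Q.rep_mem' B)), fun B B' h => ?_⟩⟩, ?_⟩
    · rw [← Q.block_rep B, ← Q.block_rep B', Q.block_eq_block_iff]
      exact (hQ _ _).2 h
    · funext B
      rw [← P.block_rep B, colouring_block]
      refine (hQ _ _).1 ?_
      rw [← Q.block_eq_block_iff (Q.rep_mem' _) (P.rep_mem' _), Q.block_rep]

open Classical in
-- Both sides count the maps from the blocks of `P` to `K` colours, the left one sorted by the fibre
-- partition.
lemma sum_descFactorial_card (P : Finpartition s) (K : ℕ) :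
    ∑ Q : Finpartition s with P ≤ Q, K.descFactorial Q.parts.card = K ^ P.parts.card := by
  have h := Fintype.card_congr (Equiv.ofBijective _ (P.colouring_bijective (Fin K)))
  rw [Fintype.card_sigma, Fintype.card_fun, Fintype.card_fin, Fintype.card_coe] at h
  rw [← h, Finset.sum_subtype (p := fun Q => P ≤ Q) _ (by simp)]
  refine Finset.sum_congr rfl fun Q _ => ?_
  rw [Fintype.card_embedding_eq, Fintype.card_fin, Fintype.card_coe]

/-- The coefficients `(-1)^(k-1) (k-1)!` of the cumulants. -/
def cumulantCoeff (k : ℕ) : ℝ := (-1) ^ (k - 1) * ((k - 1)! : ℝ)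

/-- After removing the factor X, the linear coefficient is the value at 0 of (X - 1)⋯(X - k + 1). -/
lemma coeff_one_descPochhammer {k : ℕ} (hk : k ≠ 0) :
    (descPochhammer ℝ k).coeff 1 = cumulantCoeff k := by
  obtain ⟨k, rfl⟩ := Nat.exists_eq_succ_of_ne_zero hk
  rw [Nat.succ_eq_add_one, descPochhammer_succ_left, Polynomial.coeff_X_mul (n := 0),
    Polynomial.coeff_zero_eq_eval_zero, Polynomial.eval_comp]
  simp only [cumulantCoeff, Nat.add_sub_cancel]
  induction k with
  | zero => simp
  | succ k ih =>
    rw [descPochhammer_succ_eval, ih (by omega), Nat.factorial_succ, pow_succ]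
    simp
    ring

open Classical in
/-- The Möbius inversion identity of the partition lattice. -/
theorem sum_cumulantCoeff (hs : s.Nonempty) (P : Finpartition s) :
    ∑ Q : Finpartition s with P ≤ Q, cumulantCoeff Q.parts.card =
      if P.parts.card = 1 then 1 else 0 := by
  -- The colouring count holds at every natural number, hence as a polynomial identity; the claim
  -- compares the coefficients of X.
  have hp : ∑ Q : Finpartition s with P ≤ Q, descPochhammer ℝ Q.parts.card =
      Polynomial.X ^ P.parts.card := by
    refine Polynomial.eq_of_infinite_eval_eq _ _
      ((Set.infinite_range_of_injective (Nat.cast_injective (R := ℝ))).mono ?_)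
    rintro _ ⟨K, rfl⟩
    simp only [Set.mem_ofPred_eq, Polynomial.eval_finsetSum, descPochhammer_eval_eq_descFactorial,
      Polynomial.eval_pow, Polynomial.eval_X]
    exact_mod_cast P.sum_descFactorial_card K
  have h1 := congrArg (fun p => Polynomial.coeff p 1) hp
  simp only [Polynomial.finsetSum_coeff, Polynomial.coeff_X_pow] at h1
  rw [← Finset.sum_congr rfl fun Q _ => coeff_one_descPochhammer
    (Finset.card_pos.2 (Q.parts_nonempty hs.ne_empty)).ne', h1]
  simp only [eq_comm]

open Classical in
-- With n = |s|, the factorial (k-1)! is at most n(n-1)⋯(n-k+1) for k ≤ n. These falling factorials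
-- sum to n^|P| ≤ n^n ≤ n! eⁿ, so the exponent n + 1 leaves slack.
lemma sum_factorial_card_le (P : Finpartition s) (hs : s.Nonempty) :
    ∑ Q : Finpartition s with P ≤ Q, ((Q.parts.card - 1)! : ℝ) ≤
      (s.card ! : ℝ) * Real.exp (s.card + 1) := by
  have h1 : ∑ Q : Finpartition s with P ≤ Q, ((Q.parts.card - 1)! : ℝ) ≤
      ∑ Q : Finpartition s with P ≤ Q, (s.card.descFactorial Q.parts.card : ℝ) := by
    refine Finset.sum_le_sum fun Q _ => ?_
    rw [Nat.descFactorial_eq_factorial_mul_choose]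
    refine Nat.cast_le.2 ((Nat.factorial_le (Nat.sub_le _ _)).trans
      (Nat.le_mul_of_pos_right _ (Nat.choose_pos Q.card_parts_le_card)))
  have h2 : ∑ Q : Finpartition s with P ≤ Q, (s.card.descFactorial Q.parts.card : ℝ) ≤
      (s.card : ℝ) ^ s.card := by
    have := P.sum_descFactorial_card s.card
    have h3 : s.card ^ P.parts.card ≤ s.card ^ s.card :=
      Nat.pow_le_pow_right hs.card_pos P.card_parts_le_card
    exact_mod_cast this ▸ h3
  have h3 := Real.pow_div_factorial_le_exp (x := (s.card : ℝ)) (by positivity) s.card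
  rw [div_le_iff₀' (by positivity)] at h3
  refine h1.trans (h2.trans (h3.trans ?_))
  exact mul_le_mul_of_nonneg_left (Real.exp_le_exp.2 (by linarith)) (by positivity)

lemma card_parts_eq_one_iff (hs : s.Nonempty) (P : Finpartition s) :
    P.parts.card = 1 ↔ ∀ a ∈ s, ∀ b ∈ s, P.part a = P.part b := by
  rw [Finset.card_eq_one]
  constructor
  · rintro ⟨X, hX⟩ a ha b hb
    have h1 := P.part_mem.2 ha
    have h2 := P.part_mem.2 hb
    rw [hX, Finset.mem_singleton] at h1 h2
    rw [h1, h2]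
  · intro h
    obtain ⟨a, ha⟩ := hs
    refine ⟨P.part a, Finset.eq_singleton_iff_unique_mem.2 ⟨P.part_mem.2 ha, fun Y hY => ?_⟩⟩
    obtain ⟨y, hy⟩ := P.nonempty_of_mem_parts hY
    rw [← P.part_eq_of_mem hY hy]
    exact h y (P.subset hY hy) a ha

open Classical in
/-- The finest coarsening of `P` in which all blocks that meet `T` are united. -/
def unite (P : Finpartition s) (T : Finset α) : Finpartition s :=
  ofSetSetoid (Setoid.ker fun a => if (T ∩ P.part a).Nonempty then s else P.part a) s

lemma part_unite_eq_iff (P : Finpartition s) {T : Finset α} (hT : T.Nonempty) (hTs : T ⊆ s)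
    {a b : α} (ha : a ∈ s) (hb : b ∈ s) : (P.unite T).part a = (P.unite T).part b ↔
      ((T ∩ P.part a).Nonempty ∧ (T ∩ P.part b).Nonempty) ∨ P.part a = P.part b := by
  rw [← mem_part_iff_part_eq_part _ ha hb, unite, mem_part_ofSetSetoid_iff_rel, Setoid.ker_def]
  -- The key `s`, shared by the blocks that meet `T`, cannot be the own key of a block that misses
  -- `T`.
  have key : ∀ c, ¬ (T ∩ P.part c).Nonempty → P.part c ≠ s := by
    intro c hc h
    rw [h, Finset.inter_eq_left.2 hTs] at hc
    exact hc hT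
  have := key a
  have := key b
  grind

/-- Turns the condition that `T` lies in one block of `Q` into an order condition, to which Möbius
inversion applies. -/
lemma unite_le_iff (P Q : Finpartition s) {T : Finset α} (hT : T.Nonempty) (hTs : T ⊆ s) :
    P.unite T ≤ Q ↔ P ≤ Q ∧ ∃ B ∈ Q.parts, T ⊆ B := by
  constructor
  · intro h
    refine ⟨(le_of_part_eq_part fun a ha b hb hab =>
      (P.part_unite_eq_iff hT hTs ha hb).2 (Or.inr hab)).trans h, ?_⟩
    obtain ⟨t, ht⟩ := hT
    refine ⟨Q.part t, Q.part_mem.2 (hTs ht), fun u hu => ?_⟩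
    rw [Q.mem_part_iff_part_eq_part (hTs hu) (hTs ht)]
    refine part_eq_part_of_le h (hTs hu) (hTs ht)
      ((P.part_unite_eq_iff ⟨t, ht⟩ hTs (hTs hu) (hTs ht)).2 (Or.inl ⟨?_, ?_⟩))
    · exact ⟨u, Finset.mem_inter.2 ⟨hu, P.mem_part_self.2 (hTs hu)⟩⟩
    · exact ⟨t, Finset.mem_inter.2 ⟨ht, P.mem_part_self.2 (hTs ht)⟩⟩
  · rintro ⟨hPQ, B, hB, hTB⟩
    refine le_of_part_eq_part fun a ha b hb hab => ?_
    rcases (P.part_unite_eq_iff hT hTs ha hb).1 hab with ⟨h1, h2⟩ | h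
    · have key : ∀ {c}, c ∈ s → (T ∩ P.part c).Nonempty → Q.part c = B := by
        rintro c hc ⟨u, hu⟩
        rw [Finset.mem_inter] at hu
        rw [← Q.part_eq_of_mem hB (hTB hu.1)]
        refine part_eq_part_of_le hPQ hc (hTs hu.1) ?_
        exact ((P.mem_part_iff_part_eq_part (hTs hu.1) hc).1 hu.2).symm
      rw [key ha h1, key hb h2]
    · exact part_eq_part_of_le hPQ ha hb h

lemma card_parts_unite (hs : s.Nonempty) (P : Finpartition s) {T : Finset α} (hT : T.Nonempty)
    (hTs : T ⊆ s) : (P.unite T).parts.card = 1 ↔ ∀ X ∈ P.parts, (T ∩ X).Nonempty := by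
  rw [card_parts_eq_one_iff hs]
  constructor
  · intro h X hX
    obtain ⟨x, hx⟩ := P.nonempty_of_mem_parts hX
    obtain ⟨t, ht⟩ := hT
    have ht' : t ∈ T ∩ P.part t := Finset.mem_inter.2 ⟨ht, P.mem_part_self.2 (hTs ht)⟩
    rw [← P.part_eq_of_mem hX hx]
    rcases (P.part_unite_eq_iff ⟨t, ht⟩ hTs (P.subset hX hx) (hTs ht)).1
      (h x (P.subset hX hx) t (hTs ht)) with h | h
    · exact h.1
    · rw [h]
      exact ⟨t, ht'⟩
  · intro h a ha b hb
    exact (P.part_unite_eq_iff hT hTs ha hb).2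
      (Or.inl ⟨h _ (P.part_mem.2 ha), h _ (P.part_mem.2 hb)⟩)

open Classical in
-- The Möbius identity at `P.unite T`; this is the origin of the sets that meet every block in the
-- hierarchy.
lemma sum_cumulantCoeff_of_subset (hs : s.Nonempty) (P : Finpartition s) {T : Finset α}
    (hT : T.Nonempty) (hTs : T ⊆ s) :
    ∑ Q : Finpartition s with P ≤ Q ∧ ∃ B ∈ Q.parts, T ⊆ B, cumulantCoeff Q.parts.card =
      if ∀ X ∈ P.parts, (T ∩ X).Nonempty then 1 else 0 := by
  simp_rw [← P.unite_le_iff _ hT hTs, sum_cumulantCoeff hs, P.card_parts_unite hs hT hTs]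

end Finpartition

/-! ### Exponential and logarithm over set partitions -/

section SetFunctions
variable {α : Type*} [DecidableEq α]
open Finpartition

/-- The sum over the partitions of a set of the products over the blocks. -/
def partitionExp (a : Finset α → ℝ) (Z : Finset α) : ℝ :=
  ∑ P : Finpartition Z, ∏ X ∈ P.parts, a X

/-- The inverse of `partitionExp`. -/
def partitionLog (b : Finset α → ℝ) (Z : Finset α) : ℝ :=
  ∑ Q : Finpartition Z, cumulantCoeff Q.parts.card * ∏ X ∈ Q.parts, b X

open Classical in
-- Partitioning each block of `Q` is the same as refining `Q`: `bind` glues the partitions together,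
-- and restriction to the blocks inverts it.
lemma prod_partitionExp (a : Finset α → ℝ) {Z : Finset α} (Q : Finpartition Z) :
    ∏ W ∈ Q.parts, partitionExp a W =
      ∑ P : Finpartition Z with P ≤ Q, ∏ X ∈ P.parts, a X := by
  simp only [partitionExp]
  rw [Finset.prod_sum]
  refine Finset.sum_bij (fun p _ => Q.bind p) ?_ ?_ ?_ ?_
  · intro p _
    simp only [Finset.mem_filter, Finset.mem_univ, true_and]
    intro b hb
    obtain ⟨A, hA, hb⟩ := mem_bind.1 hb
    exact ⟨A, hA, (p A hA).le hb⟩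
  · intro p _ p' _ h
    have aux : ∀ {p p' : ∀ A ∈ Q.parts, Finpartition A}, Q.bind p = Q.bind p' →
        ∀ A (hA : A ∈ Q.parts) b, b ∈ (p A hA).parts → b ∈ (p' A hA).parts := by
      intro p p' h A hA b hb
      have h1 : b ∈ (Q.bind p').parts := h ▸ mem_bind.2 ⟨A, hA, hb⟩
      obtain ⟨A', hA', hb'⟩ := mem_bind.1 h1
      obtain ⟨x, hx⟩ := (p A hA).nonempty_of_mem_parts hb
      obtain rfl := Q.eq_of_mem_parts hA hA' ((p A hA).subset hb hx) ((p' A' hA').subset hb' hx)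
      exact hb'
    funext A hA
    ext b
    exact ⟨aux h A hA b, aux h.symm A hA b⟩
  · intro P hP
    simp only [Finset.mem_filter, Finset.mem_univ, true_and] at hP
    refine ⟨fun A hA => P.restrict (Q.le hA), by simp, ?_⟩
    ext b
    rw [mem_bind]
    simp only [restrict, Finset.mem_erase, Finset.mem_image, Finset.bot_eq_empty,
      Finset.inf_eq_inter]
    constructor
    · rintro ⟨A, hA, hne, B, hB, rfl⟩
      obtain ⟨C, hC, hBC⟩ := hP hB
      obtain ⟨x, hx⟩ := Finset.nonempty_iff_ne_empty.2 hne
      rw [Finset.mem_inter] at hx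
      obtain rfl := Q.eq_of_mem_parts hC hA (hBC hx.1) hx.2
      rwa [Finset.inter_eq_left.2 hBC]
    · intro hb
      obtain ⟨C, hC, hbC⟩ := hP hb
      exact ⟨C, hC, P.ne_empty hb, b, hb, Finset.inter_eq_left.2 hbC⟩
  · intro p _
    rw [bind_parts, Finset.prod_biUnion]
    rintro ⟨A, hA⟩ - ⟨B, hB⟩ - hAB
    rw [Function.onFun, Finset.disjoint_left]
    intro b hb hb'
    obtain ⟨x, hx⟩ := (p A hA).nonempty_of_mem_parts hb
    exact hAB (Subtype.ext (Q.eq_of_mem_parts hA hB ((p A hA).subset hb hx)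
      ((p B hB).subset hb' hx)))

open Classical in
lemma parts_eq_singleton_of_card_eq_one {Z : Finset α} {P : Finpartition Z}
    (h : P.parts.card = 1) : P.parts = {Z} := by
  obtain ⟨W, hW⟩ := Finset.card_eq_one.1 h
  have := P.sup_parts
  rw [hW, Finset.sup_singleton] at this
  rw [hW]
  exact congrArg _ this

open Classical in
lemma card_parts_indiscrete {Z : Finset α} (hZ : Z ≠ ⊥) (P : Finpartition Z) :
    P.parts.card = 1 ↔ P = indiscrete hZ := by
  constructor
  · intro h
    ext1
    rw [parts_eq_singleton_of_card_eq_one h, indiscrete_parts]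
  · rintro rfl
    simp

/-- After the two sums are exchanged, the Möbius identity leaves only the one-block partition. -/
lemma partitionLog_partitionExp (a : Finset α → ℝ) {Z : Finset α} (hZ : Z.Nonempty) :
    partitionLog (partitionExp a) Z = a Z := by
  classical
  simp only [partitionLog, prod_partitionExp, Finset.mul_sum]
  simp_rw [Finset.sum_filter]
  rw [Finset.sum_comm]
  have h : ∀ P : Finpartition Z, (∑ Q : Finpartition Z,
      if P ≤ Q then cumulantCoeff Q.parts.card * ∏ X ∈ P.parts, a X else 0) =
      if P = indiscrete hZ.ne_empty then a Z else 0 := by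
    intro P
    rw [← Finset.sum_filter, ← Finset.sum_mul, sum_cumulantCoeff hZ]
    simp only [card_parts_indiscrete (show Z ≠ ⊥ from hZ.ne_empty)]
    split_ifs with h
    · rw [h]
      simp
    · simp
  simp_rw [h]
  simp

/-- Apply the other inversion to `partitionLog b`. In the resulting equality of two logarithms the
terms with more than one block agree by induction, so the one-block terms agree. -/
lemma partitionExp_partitionLog (b : Finset α → ℝ) {Z : Finset α} (hZ : Z.Nonempty) :
    partitionExp (partitionLog b) Z = b Z := by
  classical
  induction Z using Finset.strongInduction with
  | H Z ih =>
  have h1 := partitionLog_partitionExp (partitionLog b) hZ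
  simp only [partitionLog] at h1
  rw [← Finset.add_sum_erase _ _ (Finset.mem_univ (indiscrete hZ.ne_empty)),
    ← Finset.add_sum_erase (Finset.univ : Finset (Finpartition Z)) (fun Q =>
      cumulantCoeff Q.parts.card * ∏ X ∈ Q.parts, b X)
      (Finset.mem_univ (indiscrete hZ.ne_empty))] at h1
  have h2 : ∀ Q ∈ (Finset.univ : Finset (Finpartition Z)).erase (indiscrete hZ.ne_empty),
      cumulantCoeff Q.parts.card * ∏ X ∈ Q.parts, partitionExp (partitionLog b) X =
      cumulantCoeff Q.parts.card * ∏ X ∈ Q.parts, b X := by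
    intro Q hQ
    congr 1
    refine Finset.prod_congr rfl fun X hX => ih X ?_ (Q.nonempty_of_mem_parts hX)
    refine (Finset.ssubset_iff_subset_ne).2 ⟨Q.subset hX, ?_⟩
    rintro rfl
    refine (Finset.mem_erase.1 hQ).1 ((card_parts_indiscrete _ Q).1 ?_)
    rw [Finset.card_eq_one]
    refine ⟨X, Finset.eq_singleton_iff_unique_mem.2 ⟨hX, fun Y hY => ?_⟩⟩
    obtain ⟨y, hy⟩ := Q.nonempty_of_mem_parts hY
    exact Q.eq_of_mem_parts hY hX hy (Q.subset hY hy)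
  rw [Finset.sum_congr rfl h2, add_left_inj] at h1
  simpa [cumulantCoeff] using h1

end SetFunctions

/-! ### Symmetric families and relabelling -/

section Labels
variable {α : Type*}

/-- Symmetry under permutations of the arguments, for families of functions of `n ≥ 1` variables. -/
def IsSymmetricFamily (g : (n : ℕ) → (Fin n → α) → ℝ) : Prop :=
  ∀ n, 1 ≤ n → ∀ (σ : Equiv.Perm (Fin n)) (x : Fin n → α), g n (x ∘ σ) = g n x

/-- Two injective enumerations of the same set differ by a permutation. -/
lemma IsSymmetricFamily.apply_eq {g : (n : ℕ) → (Fin n → α) → ℝ} (hg : IsSymmetricFamily g)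
    {β : Type*} (x : β → α) {k k' : ℕ} (hk : 1 ≤ k) {a : Fin k → β} {b : Fin k' → β}
    (ha : Function.Injective a) (hb : Function.Injective b) (hab : Set.range a = Set.range b) :
    g k (x ∘ a) = g k' (x ∘ b) := by
  obtain rfl : k = k' := by
    have h1 := Set.ncard_range_of_injective ha
    have h2 := Set.ncard_range_of_injective hb
    rw [hab, h2] at h1
    simpa using h1.symm
  let σ : Equiv.Perm (Fin k) :=
    ((Equiv.ofInjective a ha).trans (Equiv.setCongr hab)).trans (Equiv.ofInjective b hb).symm
  have h : a = b ∘ σ := by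
    funext j
    have := congrArg Subtype.val ((Equiv.ofInjective b hb).apply_symm_apply
      (((Equiv.ofInjective a ha).trans (Equiv.setCongr hab)) j))
    exact this.symm
  rw [h, ← Function.comp_assoc, hg k hk]

/-- The set function `X ↦ g_{|X|}(x_X)`. -/
def labelled {n : ℕ} (g : (n : ℕ) → (Fin n → α) → ℝ) (x : Fin n → α) (X : Finset (Fin n)) : ℝ :=
  g X.card (restr X x)

/-- The increasing enumeration of `X`. -/
def enum {n : ℕ} (X : Finset (Fin n)) : Fin X.card ↪ Fin n := (X.orderEmbOfFin rfl).toEmbedding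

lemma restr_eq_comp {n : ℕ} (X : Finset (Fin n)) (x : Fin n → α) : restr X x = x ∘ enum X := rfl

lemma range_enum {n : ℕ} (X : Finset (Fin n)) : Set.range (enum X) = X :=
  X.range_orderEmbOfFin rfl

lemma map_enum {n : ℕ} (X : Finset (Fin n)) : Finset.univ.map (enum X) = X := by
  rw [← Finset.coe_inj, Finset.coe_map, Finset.coe_univ, Set.image_univ, range_enum]

/-- `e` need not be monotone, so the two increasing enumerations may differ; symmetry absorbs the
difference. -/
lemma labelled_comp {g : (n : ℕ) → (Fin n → α) → ℝ} (hg : IsSymmetricFamily g) {m n : ℕ}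
    (e : Fin m ↪ Fin n) (x : Fin n → α) {X : Finset (Fin m)} (hX : X.Nonempty) :
    labelled g (x ∘ e) X = labelled g x (X.map e) := by
  refine hg.apply_eq x (a := e ∘ enum X) (b := enum (X.map e)) hX.card_pos
    (e.injective.comp (enum X).injective) (enum _).injective ?_
  rw [Set.range_comp, range_enum, range_enum, Finset.coe_map]

lemma labelled_univ {g : (n : ℕ) → (Fin n → α) → ℝ} (hg : IsSymmetricFamily g) {n : ℕ}
    (hn : 1 ≤ n) (x : Fin n → α) : labelled g x Finset.univ = g n x := by
  refine hg.apply_eq x (a := enum (Finset.univ : Finset (Fin n))) (b := id) (by simpa)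
    (enum _).injective Function.injective_id ?_
  rw [range_enum, Finset.coe_univ, Set.range_id]

end Labels

/-! ### Partitions under an embedding of labels -/

section MapPartition
variable {α β : Type*} [DecidableEq α] [DecidableEq β]

/-- The image of a partition under an embedding. -/
def Finpartition.mapEmb (e : α ↪ β) {s : Finset α} (P : Finpartition s) :
    Finpartition (s.map e) where
  parts := P.parts.map (Finset.mapEmbedding e).toEmbedding
  supIndep := by
    rw [Finset.supIndep_iff_pairwiseDisjoint]
    intro X hX Y hY hXY
    simp only [Finset.coe_map, Set.mem_image, Finset.mem_coe] at hX hY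
    obtain ⟨X, hX, rfl⟩ := hX
    obtain ⟨Y, hY, rfl⟩ := hY
    exact (Finset.disjoint_map e).2 (P.disjoint hX hY fun h => hXY (by rw [h]))
  sup_parts := by
    ext b
    simp only [Finset.mem_sup, Finset.mem_map, id]
    constructor
    · rintro ⟨_, ⟨X, hX, rfl⟩, hb⟩
      obtain ⟨a, ha, rfl⟩ := Finset.mem_map.1 hb
      exact ⟨a, P.subset hX ha, rfl⟩
    · rintro ⟨a, ha, rfl⟩
      obtain ⟨X, hX, haX⟩ := P.exists_mem ha
      exact ⟨_, ⟨X, hX, rfl⟩, Finset.mem_map.2 ⟨a, haX, rfl⟩⟩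
  bot_notMem := by
    simp only [Finset.mem_map, not_exists, not_and]
    intro X hX h
    exact P.ne_bot hX (Finset.map_eq_empty.1 h)

lemma Finpartition.mapEmb_bijective (e : α ↪ β) (s : Finset α) :
    Function.Bijective (Finpartition.mapEmb e (s := s)) := by
  classical
  constructor
  · intro P Q h
    exact Finpartition.ext (Finset.map_injective _ (congrArg Finpartition.parts h))
  · intro P
    let pre : Finset β → Finset α := fun X => X.preimage e e.injective.injOn
    have hpre : ∀ X ∈ P.parts, (pre X).map e = X := fun X hX => by
      rw [Finset.map_eq_image, Finset.image_preimage, Finset.filter_true_of_mem]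
      intro b hb
      obtain ⟨a, _, rfl⟩ := Finset.mem_map.1 (P.subset hX hb)
      exact ⟨a, rfl⟩
    refine ⟨⟨P.parts.image pre, ?_, ?_, ?_⟩, ?_⟩
    · rw [Finset.supIndep_iff_pairwiseDisjoint]
      intro X hX Y hY hXY
      simp only [Finset.coe_image, Set.mem_image, Finset.mem_coe] at hX hY
      obtain ⟨X, hX, rfl⟩ := hX
      obtain ⟨Y, hY, rfl⟩ := hY
      refine (Finset.disjoint_map e).1 ?_
      simp only [id, hpre X hX, hpre Y hY]
      exact P.disjoint hX hY fun h => hXY (by rw [h])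
    · ext a
      simp only [Finset.mem_sup, Finset.mem_image, id]
      constructor
      · rintro ⟨_, ⟨X, hX, rfl⟩, ha⟩
        exact (Finset.mem_map' e).1 (P.subset hX (Finset.mem_preimage.1 ha))
      · intro ha
        obtain ⟨X, hX, haX⟩ := P.exists_mem ((Finset.mem_map' e).2 ha)
        exact ⟨_, ⟨X, hX, rfl⟩, Finset.mem_preimage.2 haX⟩
    · simp only [Finset.mem_image, not_exists, not_and]
      intro X hX h
      have := hpre X hX
      rw [h] at this
      exact P.ne_bot hX (this.symm.trans (Finset.map_empty e))
    · refine Finpartition.ext ?_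
      ext X
      simp only [mapEmb, Finset.mem_map, Finset.mem_image]
      constructor
      · rintro ⟨_, ⟨Y, hY, rfl⟩, rfl⟩
        change (pre Y).map e ∈ P.parts
        rwa [hpre Y hY]
      · intro hX
        exact ⟨_, ⟨X, hX, rfl⟩, hpre X hX⟩

/-- Used to read a sum over partitions of all labels of a cluster as one over partitions of a block
inside the larger system. -/
lemma partitionExp_map (e : α ↪ β) {a : Finset α → ℝ} {b : Finset β → ℝ} {s : Finset α}
    (h : ∀ X, X.Nonempty → X ⊆ s → a X = b (X.map e)) :
    partitionExp a s = partitionExp b (s.map e) := by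
  refine Fintype.sum_bijective _ (Finpartition.mapEmb_bijective e s) _ _ fun P => ?_
  rw [Finpartition.mapEmb, Finset.prod_map]
  exact Finset.prod_congr rfl fun X hX => h X (P.nonempty_of_mem_parts hX) (P.subset hX)

lemma partitionLog_map (e : α ↪ β) {a : Finset α → ℝ} {b : Finset β → ℝ} {s : Finset α}
    (h : ∀ X, X.Nonempty → X ⊆ s → a X = b (X.map e)) :
    partitionLog a s = partitionLog b (s.map e) := by
  refine Fintype.sum_bijective _ (Finpartition.mapEmb_bijective e s) _ _ fun P => ?_
  rw [Finpartition.mapEmb, Finset.prod_map, Finset.card_map]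
  congr 1
  exact Finset.prod_congr rfl fun X hX => h X (P.nonempty_of_mem_parts hX) (P.subset hX)

end MapPartition

/-! ### The Liouville operators as vector fields on phase space -/

section Fields
variable {ν n : ℕ}

/-- The embedding of the positions of the particle `i` into the phase space. -/
def injQ (ν : ℕ) {n : ℕ} (i : Fin n) : EuclideanSpace ℝ (Fin ν) →L[ℝ] PhaseN ν n :=
  (ContinuousLinearMap.single ℝ (fun _ : Fin n => Phase ν) i).comp
    (ContinuousLinearMap.inl ℝ _ _)

/-- The embedding of the momenta of the particle `i` into the phase space. -/
def injP (ν : ℕ) {n : ℕ} (i : Fin n) : EuclideanSpace ℝ (Fin ν) →L[ℝ] PhaseN ν n :=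
  (ContinuousLinearMap.single ℝ (fun _ : Fin n => Phase ν) i).comp
    (ContinuousLinearMap.inr ℝ _ _)

lemma injQ_apply (i : Fin n) (w : EuclideanSpace ℝ (Fin ν)) :
    injQ ν i w = Pi.single i (w, 0) := rfl

lemma injP_apply (i : Fin n) (w : EuclideanSpace ℝ (Fin ν)) :
    injP ν i w = Pi.single i (0, w) := rfl

lemma update_eq_add_single (x : PhaseN ν n) (i : Fin n) (v : Phase ν) :
    Function.update x i v = x + Pi.single i (v - x i) := by
  funext j
  by_cases h : j = i
  · subst h; simp
  · simp [h]

lemma gradQ_eq {F : PhaseN ν n → ℝ} {x : PhaseN ν n} (hF : DifferentiableAt ℝ F x) (i : Fin n) :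
    gradQ i F x = (InnerProductSpace.toDual ℝ _).symm ((fderiv ℝ F x).comp (injQ ν i)) := by
  have h1 : (fun y => Function.update x i (y, (x i).2)) =
      fun y => x + injQ ν i (y - (x i).1) := by
    funext y
    rw [update_eq_add_single, injQ_apply]
    congr 2
    ext <;> simp
  have h2 : HasFDerivAt (fun y => Function.update x i (y, (x i).2)) (injQ ν i) (x i).1 := by
    rw [h1]
    exact ((injQ ν i).hasFDerivAt.comp _ ((hasFDerivAt_id _).sub_const _)).const_add x
  have h3 : HasFDerivAt F (fderiv ℝ F x) (Function.update x i ((x i).1, (x i).2)) := by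
    simpa using hF.hasFDerivAt
  rw [gradQ, gradient, ← (HasFDerivAt.comp
    (f := fun y => Function.update x i (y, (x i).2)) (x i).1 h3 h2).fderiv]
  rfl

lemma gradP_eq {F : PhaseN ν n → ℝ} {x : PhaseN ν n} (hF : DifferentiableAt ℝ F x) (i : Fin n) :
    gradP i F x = (InnerProductSpace.toDual ℝ _).symm ((fderiv ℝ F x).comp (injP ν i)) := by
  have h1 : (fun y => Function.update x i ((x i).1, y)) =
      fun y => x + injP ν i (y - (x i).2) := by
    funext y
    rw [update_eq_add_single, injP_apply]
    congr 2
    ext <;> simp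
  have h2 : HasFDerivAt (fun y => Function.update x i ((x i).1, y)) (injP ν i) (x i).2 := by
    rw [h1]
    exact ((injP ν i).hasFDerivAt.comp _ ((hasFDerivAt_id _).sub_const _)).const_add x
  have h3 : HasFDerivAt F (fderiv ℝ F x) (Function.update x i ((x i).1, (x i).2)) := by
    simpa using hF.hasFDerivAt
  rw [gradP, gradient, ← (HasFDerivAt.comp
    (f := fun y => Function.update x i ((x i).1, y)) (x i).2 h3 h2).fderiv]
  rfl

lemma inner_gradQ {F : PhaseN ν n → ℝ} {x : PhaseN ν n} (hF : DifferentiableAt ℝ F x) (i : Fin n)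
    (w : EuclideanSpace ℝ (Fin ν)) : inner ℝ w (gradQ i F x) = fderiv ℝ F x (injQ ν i w) := by
  rw [gradQ_eq hF, real_inner_comm, InnerProductSpace.toDual_symm_apply]
  rfl

lemma inner_gradP {F : PhaseN ν n → ℝ} {x : PhaseN ν n} (hF : DifferentiableAt ℝ F x) (i : Fin n)
    (w : EuclideanSpace ℝ (Fin ν)) : inner ℝ w (gradP i F x) = fderiv ℝ F x (injP ν i w) := by
  rw [gradP_eq hF, real_inner_comm, InnerProductSpace.toDual_symm_apply]
  rfl

lemma contDiff_gradQ {F : PhaseN ν n → ℝ} (hF : ContDiff ℝ 2 F) (i : Fin n) :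
    ContDiff ℝ 1 (gradQ i F) := by
  have h : gradQ i F = fun x =>
      (InnerProductSpace.toDual ℝ _).symm ((fderiv ℝ F x).comp (injQ ν i)) :=
    funext fun x => gradQ_eq (hF.differentiable two_ne_zero x) i
  rw [h]
  exact (InnerProductSpace.toDual ℝ (EuclideanSpace ℝ (Fin ν))).symm.toContinuousLinearEquiv.contDiff.comp
    ((hF.fderiv_right (m := 1) (by norm_num)).clm_comp contDiff_const)

lemma gradQ_comp {m : ℕ} (e : Fin m ↪ Fin n) {F : PhaseN ν m → ℝ} {F' : PhaseN ν n → ℝ}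
    (h : ∀ x, F (x ∘ e) = F' x) (x : PhaseN ν n) (j : Fin m) :
    gradQ j F (x ∘ e) = gradQ (e j) F' x := by
  simp only [gradQ, ← h, Function.update_comp_eq_of_injective _ e.injective, Function.comp_apply]

lemma gradQ_congr_position {F : PhaseN ν n → ℝ}
    (hF : ∀ x y : PhaseN ν n, (∀ i, (x i).1 = (y i).1) → F x = F y) {x y : PhaseN ν n}
    (h : ∀ i, (x i).1 = (y i).1) (i : Fin n) : gradQ i F x = gradQ i F y := by
  simp only [gradQ, h i]
  congr 1
  funext q
  refine hF _ _ fun j => ?_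
  by_cases hj : j = i
  · subst hj; simp
  · simp [hj, h j]

lemma gradQ_eq_zero {F : PhaseN ν n → ℝ} {i : Fin n}
    (hF : ∀ (x : PhaseN ν n) v, F (Function.update x i v) = F x) (x : PhaseN ν n) :
    gradQ i F x = 0 := by
  simp only [gradQ, hF]
  exact gradient_const _ _

variable {Φ : Potentials ν}

lemma AdmissiblePotentials.isSymmetricFamily (hΦ : AdmissiblePotentials Φ) :
    IsSymmetricFamily Φ := fun n hn σ q => hΦ.symm n hn σ q

lemma groupPotential_comp (hΦ : AdmissiblePotentials Φ) {m : ℕ} (e : Fin m ↪ Fin n)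
    {s : Finset (Fin m)} (hs : s.Nonempty) (x : PhaseN ν n) :
    groupPotential Φ s (x ∘ e) = groupPotential Φ (s.map e) x :=
  labelled_comp hΦ.isSymmetricFamily e (fun i => (x i).1) hs

lemma groupPotential_congr (s : Finset (Fin n)) {x y : PhaseN ν n}
    (h : ∀ i ∈ s, (x i).1 = (y i).1) : groupPotential Φ s x = groupPotential Φ s y := by
  unfold groupPotential
  congr 1
  funext j
  exact h _ (s.orderEmbOfFin_mem rfl j)

lemma contDiff_groupPotential (hΦ : AdmissiblePotentials Φ) {s : Finset (Fin n)}
    (hs : s.Nonempty) : ContDiff ℝ 2 (groupPotential Φ s : PhaseN ν n → ℝ) :=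
  (hΦ.smooth s.card hs.card_pos).comp
    (contDiff_pi.2 fun j => contDiff_fst.comp (contDiff_apply ℝ (Phase ν) (enum s j)))

instance : (volume : Measure (Phase ν)).IsAddHaarMeasure :=
  inferInstanceAs ((volume : Measure (EuclideanSpace ℝ (Fin ν))).prod
    (volume : Measure (EuclideanSpace ℝ (Fin ν)))).IsAddHaarMeasure

instance : SigmaFinite (volume : Measure (Phase ν)) :=
  inferInstanceAs (SigmaFinite ((volume : Measure (EuclideanSpace ℝ (Fin ν))).prod
    (volume : Measure (EuclideanSpace ℝ (Fin ν)))))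

instance : (volume : Measure (PhaseN ν n)).IsAddHaarMeasure :=
  inferInstanceAs (Measure.pi fun _ : Fin n => (volume : Measure (Phase ν))).IsAddHaarMeasure

/-- The vector field of free motion. -/
def freeField (x : PhaseN ν n) : PhaseN ν n := fun i => ((x i).2, 0)

/-- The vector field of the interaction within the group `s`. -/
def intField (Φ : Potentials ν) (s : Finset (Fin n)) (x : PhaseN ν n) : PhaseN ν n :=
  fun i => (0, -gradQ i (groupPotential Φ s) x)

lemma gradQ_groupPotential_of_notMem {s : Finset (Fin n)} {i : Fin n} (hi : i ∉ s)
    (x : PhaseN ν n) : gradQ i (groupPotential Φ s) x = 0 :=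
  gradQ_eq_zero (fun x v => groupPotential_congr s fun j hj => by
    rw [Function.update_of_ne (ne_of_mem_of_not_mem hj hi)]) x

lemma contDiff_freeField : ContDiff ℝ 1 (freeField : PhaseN ν n → PhaseN ν n) :=
  contDiff_pi.2 fun i => (contDiff_snd.comp (contDiff_apply ℝ (Phase ν) i)).prodMk contDiff_const

lemma contDiff_intField (hΦ : AdmissiblePotentials Φ) {s : Finset (Fin n)} (hs : s.Nonempty) :
    ContDiff ℝ 1 (intField Φ s : PhaseN ν n → PhaseN ν n) :=
  contDiff_pi.2 fun i => contDiff_const.prodMk (contDiff_gradQ (contDiff_groupPotential hΦ hs) i).neg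

lemma euclidean_eq_sum (w : EuclideanSpace ℝ (Fin ν)) :
    w = ∑ a, w a • EuclideanSpace.single a (1 : ℝ) := by
  simpa using ((EuclideanSpace.basisFun (Fin ν) ℝ).sum_repr w).symm

lemma freeField_eq_sum (x : PhaseN ν n) : freeField x =
    ∑ i, ∑ a, (x i).2 a • injQ ν i (EuclideanSpace.single a (1 : ℝ)) := by
  simp_rw [← map_smul, ← map_sum, ← euclidean_eq_sum, injQ_apply]
  exact (Finset.univ_sum_single (freeField x)).symm

lemma intField_eq_sum (s : Finset (Fin n)) (x : PhaseN ν n) : intField Φ s x =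
    ∑ i, ∑ a, (-gradQ i (groupPotential Φ s) x) a • injP ν i (EuclideanSpace.single a (1 : ℝ)) := by
  simp_rw [← map_smul, ← map_sum, ← euclidean_eq_sum, injP_apply]
  exact (Finset.univ_sum_single (intField Φ s x)).symm

lemma isDivergenceFree_freeField :
    IsDivergenceFree volume (freeField : PhaseN ν n → PhaseN ν n) := by
  have h : (freeField : PhaseN ν n → PhaseN ν n) = fun x =>
    ∑ i, ∑ a, (x i).2 a • injQ ν i (EuclideanSpace.single a (1 : ℝ)) := funext freeField_eq_sum
  rw [h]
  refine IsDivergenceFree.sum fun i _ => IsDivergenceFree.sum fun a _ =>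
    IsDivergenceFree.smul_const (by fun_prop) fun x t => ?_
  simp [injQ_apply]

/-- The forces depend on the positions only, so every component is constant along the momentum
direction it multiplies. -/
lemma isDivergenceFree_intField (hΦ : AdmissiblePotentials Φ) {s : Finset (Fin n)}
    (hs : s.Nonempty) : IsDivergenceFree volume (intField Φ s : PhaseN ν n → PhaseN ν n) := by
  have h : (intField Φ s : PhaseN ν n → PhaseN ν n) = _ := funext (intField_eq_sum s)
  rw [h]
  refine IsDivergenceFree.sum fun i _ => IsDivergenceFree.sum fun a _ =>
    IsDivergenceFree.smul_const ?_ fun x t => ?_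
  · have := (contDiff_gradQ (contDiff_groupPotential hΦ hs) i).continuous
    fun_prop
  · rw [gradQ_congr_position (fun x y hxy => groupPotential_congr s fun i _ => hxy i) (y := x)]
    intro j
    by_cases hj : j = i
    · subst hj; simp [injP_apply]
    · simp [injP_apply, hj]

lemma fderiv_freeField {f : PhaseN ν n → ℝ} {x : PhaseN ν n} (hf : DifferentiableAt ℝ f x) :
    fderiv ℝ f x (freeField x) = ∑ i, inner ℝ (x i).2 (gradQ i f x) := by
  have h : freeField x = ∑ i, injQ ν i (x i).2 :=
    (Finset.univ_sum_single (freeField x)).symm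
  simp_rw [h, map_sum, inner_gradQ hf]

/-- The field has a component for every particle, but the group potential exerts no force on labels
outside `s`. -/
lemma fderiv_intField {f : PhaseN ν n → ℝ} {x : PhaseN ν n} (hf : DifferentiableAt ℝ f x)
    (s : Finset (Fin n)) : fderiv ℝ f x (intField Φ s x) = liouvilleInt Φ s f x := by
  have h : intField Φ s x = ∑ i, injP ν i (-gradQ i (groupPotential Φ s) x) :=
    (Finset.univ_sum_single (intField Φ s x)).symm
  rw [h, map_sum, liouvilleInt, ← Finset.sum_neg_distrib]
  symm
  refine Finset.sum_subset_zero_on_sdiff (Finset.subset_univ s) (fun i hi => ?_) fun i _ => ?_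
  · rw [gradQ_groupPotential_of_notMem (by simpa using hi)]
    simp
  · rw [inner_gradP hf, map_neg, map_neg]

open Classical in
/-- The sets of labels which interact when the blocks of `Q` are isolated systems. -/
def interacting (Q : Finpartition (Finset.univ : Finset (Fin n))) : Finset (Finset (Fin n)) :=
  {s | s.Nonempty ∧ ∃ B ∈ Q.parts, s ⊆ B}

/-- The Hamiltonian vector field of the isolated blocks of `Q`. -/
def partitionField (Φ : Potentials ν) (Q : Finpartition (Finset.univ : Finset (Fin n)))
    (x : PhaseN ν n) : PhaseN ν n :=
  freeField x + ∑ s ∈ interacting Q, intField Φ s x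

/-- The Hamiltonian vector field. -/
def hamiltonField (Φ : Potentials ν) (x : PhaseN ν n) : PhaseN ν n :=
  freeField x + ∑ s : Finset (Fin n) with s.Nonempty, intField Φ s x

lemma contDiff_hamiltonField (hΦ : AdmissiblePotentials Φ) :
    ContDiff ℝ 1 (hamiltonField Φ : PhaseN ν n → PhaseN ν n) :=
  contDiff_freeField.add (ContDiff.sum fun _ hs =>
    contDiff_intField hΦ (Finset.mem_filter.1 hs).2)

lemma contDiff_partitionField (hΦ : AdmissiblePotentials Φ)
    (Q : Finpartition (Finset.univ : Finset (Fin n))) : ContDiff ℝ 1 (partitionField Φ Q) :=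
  contDiff_freeField.add (ContDiff.sum fun _ hs =>
    contDiff_intField hΦ (Finset.mem_filter.1 hs).2.1)

lemma IsDivergenceFree.add {V W : PhaseN ν n → PhaseN ν n} (hV : IsDivergenceFree volume V)
    (hW : IsDivergenceFree volume W) : IsDivergenceFree volume (fun x => V x + W x) := by
  have := IsDivergenceFree.sum (μ := volume) (s := Finset.univ)
    (W := fun b : Bool => if b then V else W) (by
      intro b _
      cases b
      · simpa using hW
      · simpa using hV)
  simpa using this

lemma isDivergenceFree_hamiltonField (hΦ : AdmissiblePotentials Φ) :
    IsDivergenceFree volume (hamiltonField Φ : PhaseN ν n → PhaseN ν n) :=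
  isDivergenceFree_freeField.add (IsDivergenceFree.sum fun _ hs =>
    isDivergenceFree_intField hΦ (Finset.mem_filter.1 hs).2)

lemma isDivergenceFree_partitionField (hΦ : AdmissiblePotentials Φ)
    (Q : Finpartition (Finset.univ : Finset (Fin n))) :
    IsDivergenceFree volume (partitionField Φ Q) :=
  isDivergenceFree_freeField.add (IsDivergenceFree.sum fun _ hs =>
    isDivergenceFree_intField hΦ (Finset.mem_filter.1 hs).2.1)

lemma fderiv_hamiltonField {f : PhaseN ν n → ℝ} {x : PhaseN ν n} (hf : DifferentiableAt ℝ f x) :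
    fderiv ℝ f x (hamiltonField Φ x) = liouville Φ f x := by
  rw [hamiltonField, map_add, map_sum, fderiv_freeField hf, liouville]
  simp_rw [fderiv_intField hf]

lemma hasFDerivAt_kinetic (x : PhaseN ν n) :
    HasFDerivAt (fun x : PhaseN ν n => ∑ i, ‖(x i).2‖ ^ 2 / 2)
      (∑ i, (innerSL ℝ (x i).2).comp ((ContinuousLinearMap.snd ℝ _ _).comp
        (ContinuousLinearMap.proj i))) x := by
  refine HasFDerivAt.fun_sum fun i _ => ?_
  have h1 : HasFDerivAt (fun x : PhaseN ν n => (x i).2)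
      ((ContinuousLinearMap.snd ℝ (EuclideanSpace ℝ (Fin ν)) (EuclideanSpace ℝ (Fin ν))).comp
        (ContinuousLinearMap.proj i)) x :=
    ((ContinuousLinearMap.snd ℝ (EuclideanSpace ℝ (Fin ν)) (EuclideanSpace ℝ (Fin ν))).comp
        (ContinuousLinearMap.proj i : PhaseN ν n →L[ℝ] Phase ν)).hasFDerivAt
  have h2 := h1.norm_sq.mul_const (1 / 2 : ℝ)
  simp only [mul_one_div] at h2
  refine h2.congr_fderiv (ContinuousLinearMap.ext fun v => ?_)
  simp

lemma hasFDerivAt_hamiltonian (hΦ : AdmissiblePotentials Φ) (x : PhaseN ν n) :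
    HasFDerivAt (hamiltonian Φ) (∑ i, (innerSL ℝ (x i).2).comp ((ContinuousLinearMap.snd ℝ _ _).comp
        (ContinuousLinearMap.proj i)) +
      ∑ s : Finset (Fin n) with s.Nonempty, fderiv ℝ (groupPotential Φ s) x) x :=
  (hasFDerivAt_kinetic x).add (HasFDerivAt.fun_sum fun _ hs =>
    ((contDiff_groupPotential hΦ (Finset.mem_filter.1 hs).2).differentiable two_ne_zero
      x).hasFDerivAt)

lemma hamilton_equations (hΦ : AdmissiblePotentials Φ) (x : PhaseN ν n) :
    (fun i => (gradP i (hamiltonian Φ) x, -gradQ i (hamiltonian Φ) x)) = hamiltonField Φ x := by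
  have hH := hasFDerivAt_hamiltonian hΦ x
  have hd : ∀ s ∈ (Finset.univ : Finset (Finset (Fin n))).filter Finset.Nonempty,
      DifferentiableAt ℝ (groupPotential Φ s) x := fun s hs =>
    (contDiff_groupPotential hΦ (Finset.mem_filter.1 hs).2).differentiable two_ne_zero x
  have hpos : ∀ (s : Finset (Fin n)), s.Nonempty → ∀ i w,
      fderiv ℝ (groupPotential Φ s) x (injP ν i w) = 0 := by
    intro s hs i w
    rw [← inner_gradP (hd s (by simpa using hs)), gradP]
    have : (fun y => groupPotential Φ s (Function.update x i ((x i).1, y))) =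
        fun _ => groupPotential Φ s x := by
      funext y
      refine groupPotential_congr s fun j _ => ?_
      by_cases hj : j = i
      · subst hj; simp
      · simp [hj]
    rw [this, gradient_fun_const, inner_zero_right]
  funext i
  refine Prod.ext ?_ ?_
  · refine ext_inner_left ℝ fun w => ?_
    simp only [hamiltonField, freeField, intField, Pi.add_apply, Finset.sum_apply, Prod.fst_add,
      Prod.fst_sum, Finset.sum_const_zero, add_zero]
    rw [inner_gradP hH.differentiableAt, hH.fderiv]
    simp only [add_apply, sum_apply]
    rw [Finset.sum_eq_zero (s := Finset.filter _ _) fun s hs =>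
      hpos s (Finset.mem_filter.1 hs).2 i w, add_zero,
      Finset.sum_eq_single i (fun j _ hj => by simp [injP_apply, hj]) (by simp)]
    simp [injP_apply, real_inner_comm]
  · refine ext_inner_left ℝ fun w => ?_
    simp only [hamiltonField, freeField, intField, Pi.add_apply, Finset.sum_apply, Prod.snd_add,
      Prod.snd_sum, zero_add]
    rw [Finset.sum_neg_distrib, inner_neg_right, inner_neg_right, inner_sum,
      inner_gradQ hH.differentiableAt, hH.fderiv]
    simp only [add_apply, sum_apply]
    rw [Finset.sum_eq_zero (s := Finset.univ) fun j _ => ?_, zero_add]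
    · rw [Finset.sum_congr rfl fun s hs => inner_gradQ (hd s hs) i w]
    · by_cases hj : j = i
      · subst hj; simp [injQ_apply]
      · simp [injQ_apply, hj]

end Fields

/-! ### The flows of isolated clusters -/

section Flows
variable {ν n : ℕ} {Φ : Potentials ν}

lemma mem_interacting {Q : Finpartition (Finset.univ : Finset (Fin n))} {s : Finset (Fin n)} :
    s ∈ interacting Q ↔ s.Nonempty ∧ ∃ B ∈ Q.parts, s ⊆ B := by
  simp [interacting]

lemma partitionField_apply (Q : Finpartition (Finset.univ : Finset (Fin n))) (x : PhaseN ν n)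
    (i : Fin n) : partitionField Φ Q x i =
      ((x i).2, -∑ s ∈ interacting Q, gradQ i (groupPotential Φ s) x) := by
  simp only [partitionField, freeField, intField, Pi.add_apply, Finset.sum_apply]
  refine Prod.ext ?_ ?_
  · simp [Prod.fst_sum]
  · simp [Prod.snd_sum]

lemma hamiltonField_apply (x : PhaseN ν n) (i : Fin n) : hamiltonField Φ x i =
    ((x i).2, -∑ s : Finset (Fin n) with s.Nonempty, gradQ i (groupPotential Φ s) x) := by
  simp only [hamiltonField, freeField, intField, Pi.add_apply, Finset.sum_apply]
  refine Prod.ext ?_ ?_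
  · simp [Prod.fst_sum]
  · simp [Prod.snd_sum]

/-- A particle of the block feels only the groups inside the block, and these are the images under
`e` of the groups of the small system. Since `e` is any embedding onto the block, permutations are
covered too. -/
lemma hamiltonField_comp (hΦ : AdmissiblePotentials Φ) {m : ℕ}
    {Q : Finpartition (Finset.univ : Finset (Fin n))} {e : Fin m ↪ Fin n}
    (he : Finset.univ.map e ∈ Q.parts) (x : PhaseN ν n) :
    hamiltonField Φ (x ∘ e) = partitionField Φ Q x ∘ e := by
  funext j
  rw [Function.comp_apply, hamiltonField_apply, partitionField_apply]
  refine Prod.ext rfl (congrArg Neg.neg ?_)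
  rw [Finset.sum_congr rfl fun s hs => gradQ_comp e
    (fun x => groupPotential_comp hΦ e (Finset.mem_filter.1 hs).2 x) x j]
  have hej : e j ∈ Finset.univ.map e := Finset.mem_map_of_mem _ (Finset.mem_univ j)
  refine Finset.sum_of_injOn (fun s => s.map e) (Finset.map_injective e).injOn
    (fun s hs => ?_) (fun s hs hs' => ?_) (fun s _ => rfl)
  · rw [Finset.mem_coe, mem_interacting]
    exact ⟨(Finset.map_nonempty).2 (Finset.mem_filter.1 hs).2, _, he,
      Finset.map_subset_map.2 (Finset.subset_univ s)⟩
  · obtain ⟨hne, B, hB, hsB⟩ := mem_interacting.1 hs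
    refine gradQ_groupPotential_of_notMem (fun hjs => hs' ?_) x
    obtain rfl := Q.eq_of_mem_parts hB he (hsB hjs) hej
    obtain ⟨u, -, rfl⟩ := Finset.subset_map_iff.1 hsB
    exact ⟨u, by simpa using hne, rfl⟩

lemma isGlobalFlow_hamiltonFlow (hΦ : AdmissiblePotentials Φ) (hn : 1 ≤ n) :
    IsGlobalFlow (hamiltonField Φ : PhaseN ν n → PhaseN ν n) (hamiltonFlow Φ) := by
  have h : ∀ x : PhaseN ν n, IsHamiltonCurve Φ (fun t => hamiltonFlow Φ t x) ∧
      hamiltonFlow Φ 0 x = x := fun x => by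
    have hx := hΦ.global n hn x
    simp only [hamiltonFlow, dif_pos hx]
    exact hx.choose_spec
  refine ⟨fun x => (h x).2, fun t x => ?_⟩
  have := (h x).1 t
  rwa [hamilton_equations hΦ] at this

lemma partitionMove_comp_enum (Q : Finpartition (Finset.univ : Finset (Fin n)))
    {Z : Finset (Fin n)} (hZ : Z ∈ Q.parts) (t : ℝ) (x : PhaseN ν n) :
    partitionMove Φ Q t x ∘ enum Z = hamiltonFlow Φ t (x ∘ enum Z) := by
  funext k
  have hk : enum Z k ∈ Z := Z.orderEmbOfFin_mem rfl k
  change clusterMove Φ (Q.part (enum Z k)) t x (enum Z k) = _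
  rw [Q.part_eq_of_mem hZ hk, clusterMove, dif_pos hk]
  refine congrArg (hamiltonFlow Φ t (x ∘ enum Z)) ?_
  rw [OrderIso.symm_apply_eq]
  rfl

lemma exists_enum (Q : Finpartition (Finset.univ : Finset (Fin n))) (i : Fin n) :
    ∃ Z ∈ Q.parts, ∃ k, enum Z k = i := by
  obtain ⟨Z, hZ, hi⟩ := Q.exists_mem (Finset.mem_univ i)
  refine ⟨Z, hZ, ?_⟩
  rw [← Finset.mem_coe, ← range_enum] at hi
  exact hi

lemma isGlobalFlow_partitionMove (hΦ : AdmissiblePotentials Φ)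
    (Q : Finpartition (Finset.univ : Finset (Fin n))) :
    IsGlobalFlow (partitionField Φ Q) (partitionMove Φ Q) := by
  have hflow : ∀ Z ∈ Q.parts, IsGlobalFlow (hamiltonField Φ) (hamiltonFlow Φ (n := Z.card)) :=
    fun Z hZ => isGlobalFlow_hamiltonFlow hΦ (Q.nonempty_of_mem_parts hZ).card_pos
  constructor
  · intro x
    funext i
    obtain ⟨Z, hZ, k, rfl⟩ := exists_enum Q i
    have := congrFun (partitionMove_comp_enum (Φ := Φ) Q hZ 0 x) k
    rw [(hflow Z hZ).zero] at this
    exact this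
  · intro t x
    refine hasDerivAt_pi.2 fun i => ?_
    obtain ⟨Z, hZ, k, rfl⟩ := exists_enum Q i
    have h1 := hasDerivAt_pi.1 ((hflow Z hZ).deriv t (x ∘ enum Z)) k
    have h2 : ∀ t, hamiltonFlow Φ t (x ∘ enum Z) k = partitionMove Φ Q t x (enum Z k) :=
      fun t => (congrFun (partitionMove_comp_enum Q hZ t x) k).symm
    have h3 : hamiltonField Φ (hamiltonFlow Φ t (x ∘ enum Z)) k =
        partitionField Φ Q (partitionMove Φ Q t x) (enum Z k) := by
      rw [← partitionMove_comp_enum Q hZ, hamiltonField_comp hΦ (by rwa [map_enum])]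
      rfl
    rw [h3] at h1
    exact h1.congr_of_eventuallyEq (.of_forall fun t => (h2 t).symm)

lemma partitionField_indiscrete (hn : (Finset.univ : Finset (Fin n)) ≠ ⊥) (x : PhaseN ν n) :
    partitionField Φ (Finpartition.indiscrete hn) x = hamiltonField Φ x := by
  simp only [partitionField, hamiltonField]
  congr 2
  ext s
  simp [mem_interacting]

lemma univ_fin_ne_bot (hn : 1 ≤ n) : (Finset.univ : Finset (Fin n)) ≠ ⊥ := by
  have : NeZero n := ⟨by omega⟩
  exact Finset.univ_nonempty.ne_empty

/-- Permuting the particles of a Hamiltonian curve gives another one, because the field is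
equivariant; uniqueness does the rest. -/
lemma hamiltonFlow_comp_perm (hΦ : AdmissiblePotentials Φ) (hn : 1 ≤ n) (σ : Equiv.Perm (Fin n))
    (t : ℝ) (x : PhaseN ν n) : hamiltonFlow Φ t (x ∘ σ) = hamiltonFlow Φ t x ∘ σ := by
  have hf := isGlobalFlow_hamiltonFlow (n := n) hΦ hn
  have h := eq_of_integral_curves (contDiff_hamiltonField hΦ)
    (f := fun t => hamiltonFlow Φ t (x ∘ σ)) (g := fun t => hamiltonFlow Φ t x ∘ σ)
    (fun t => hf.deriv t _) (fun t => ?_) (by simp only [hf.zero])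
  · exact congrFun h t
  · have h1 := hamiltonField_comp hΦ (Q := Finpartition.indiscrete (univ_fin_ne_bot hn))
      (e := σ.toEmbedding) (by simp) (hamiltonFlow Φ t x)
    rw [Equiv.coe_toEmbedding] at h1
    rw [h1, partitionField_indiscrete]
    exact hasDerivAt_pi.2 fun i => hasDerivAt_pi.1 (hf.deriv t x) (σ i)

end Flows

/-! ### The cluster expansion as a partition logarithm -/

section Clusters
variable {ν n : ℕ} {Φ : Potentials ν} {g₀ : CorrSeq ν}

lemma blockProd_eq (g : CorrSeq ν) (P : Finpartition (Finset.univ : Finset (Fin n)))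
    (x : PhaseN ν n) : blockProd g P x = ∏ X ∈ P.parts, labelled g x X := rfl

/-- The evolved sums over all partitions: `∑_P ∏_{X ∈ P} g_{|X|}(0, X)` transported by the flow. -/
def clusterSum (Φ : Potentials ν) (g₀ : CorrSeq ν) (t : ℝ) : CorrSeq ν :=
  fun _ y => partitionExp (labelled g₀ (hamiltonFlow Φ (-t) y)) Finset.univ

lemma isSymmetricFamily_clusterSum (hΦ : AdmissiblePotentials Φ) (hg₀ : IsSymmetricFamily g₀)
    (t : ℝ) : IsSymmetricFamily (clusterSum Φ g₀ t) := by
  intro n hn σ x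
  simp only [clusterSum]
  rw [hamiltonFlow_comp_perm hΦ hn]
  have h := partitionExp_map (s := Finset.univ) σ.toEmbedding
    (fun X hX _ => labelled_comp hg₀ σ.toEmbedding (hamiltonFlow Φ (-t) x) hX)
  rwa [Finset.map_univ_equiv] at h

open Classical in
-- The isolated flow moves each block of `Q` on its own, so the sum over the refinements of `Q`
-- factorises.
lemma sum_blockProd_partitionMove (hg₀ : IsSymmetricFamily g₀) (t : ℝ)
    (Q : Finpartition (Finset.univ : Finset (Fin n))) (x : PhaseN ν n) :
    ∑ P : Finpartition (Finset.univ : Finset (Fin n)) with P ≤ Q,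
      blockProd g₀ P (partitionMove Φ Q (-t) x) = blockProd (clusterSum Φ g₀ t) Q x := by
  simp only [blockProd_eq]
  rw [← prod_partitionExp]
  refine Finset.prod_congr rfl fun Z hZ => ?_
  simp only [labelled, clusterSum, restr_eq_comp]
  rw [← partitionMove_comp_enum Q hZ, partitionExp_map (enum Z)
    (fun X hX _ => labelled_comp hg₀ (enum Z) _ hX), map_enum]

open Classical in
-- Exchange the sums over P ≤ Q; for fixed `Q` the inner sum is the factorised one.
lemma clusterExpansion_eq (hg₀ : IsSymmetricFamily g₀) (t : ℝ) (x : PhaseN ν n) :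
    clusterExpansion Φ g₀ t n x = ∑ Q : Finpartition (Finset.univ : Finset (Fin n)),
      Finpartition.cumulantCoeff Q.parts.card * blockProd (clusterSum Φ g₀ t) Q x := by
  simp only [clusterExpansion, cumulant, ← sum_blockProd_partitionMove hg₀, Finset.mul_sum,
    Finset.sum_filter]
  rw [Finset.sum_comm]
  simp only [mul_ite, mul_zero]
  rfl

lemma labelled_clusterExpansion (hΦ : AdmissiblePotentials Φ) (hg₀ : IsSymmetricFamily g₀) (t : ℝ)
    (x : PhaseN ν n) {Z : Finset (Fin n)} :
    labelled (clusterExpansion Φ g₀ t) x Z = partitionLog (labelled (clusterSum Φ g₀ t) x) Z := by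
  rw [labelled, clusterExpansion_eq hg₀]
  change partitionLog (labelled (clusterSum Φ g₀ t) (x ∘ enum Z)) Finset.univ = _
  rw [partitionLog_map (enum Z) (fun X hX _ =>
    labelled_comp (isSymmetricFamily_clusterSum hΦ hg₀ t) (enum Z) _ hX), map_enum]

lemma isSymmetricFamily_clusterExpansion (hΦ : AdmissiblePotentials Φ)
    (hg₀ : IsSymmetricFamily g₀) (t : ℝ) : IsSymmetricFamily (clusterExpansion Φ g₀ t) := by
  intro n hn σ x
  rw [clusterExpansion_eq hg₀, clusterExpansion_eq hg₀]
  change partitionLog (labelled (clusterSum Φ g₀ t) (x ∘ σ.toEmbedding)) Finset.univ =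
    partitionLog (labelled (clusterSum Φ g₀ t) x) Finset.univ
  rw [partitionLog_map σ.toEmbedding (fun X hX _ =>
    labelled_comp (isSymmetricFamily_clusterSum hΦ hg₀ t) σ.toEmbedding _ hX),
    Finset.map_univ_equiv]

open Classical in
-- The exponential undoes the logarithm on every block of `Q`.
lemma sum_blockProd_clusterExpansion (hΦ : AdmissiblePotentials Φ) (hg₀ : IsSymmetricFamily g₀)
    (t : ℝ) (Q : Finpartition (Finset.univ : Finset (Fin n))) (x : PhaseN ν n) :
    ∑ P : Finpartition (Finset.univ : Finset (Fin n)) with P ≤ Q,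
      blockProd (clusterExpansion Φ g₀ t) P x = blockProd (clusterSum Φ g₀ t) Q x := by
  simp only [blockProd_eq]
  rw [← prod_partitionExp]
  refine Finset.prod_congr rfl fun Z hZ => ?_
  have h : labelled (clusterExpansion Φ g₀ t) x = partitionLog (labelled (clusterSum Φ g₀ t) x) :=
    funext fun Z => labelled_clusterExpansion hΦ hg₀ t x
  rw [h, partitionExp_partitionLog _ (Q.nonempty_of_mem_parts hZ)]

end Clusters

/-! ### Regularity of the cluster expansion, and the hierarchy pointwise -/

section Regularity
variable {ν n : ℕ} {Φ : Potentials ν} {g₀ : CorrSeq ν}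

lemma contDiff_restr (X : Finset (Fin n)) :
    ContDiff ℝ 1 (restr X : PhaseN ν n → PhaseN ν X.card) :=
  contDiff_pi.2 fun j => contDiff_apply ℝ (Phase ν) (enum X j)

lemma contDiff_blockProd {g : CorrSeq ν} (hg : ∀ n, 1 ≤ n → ContDiff ℝ 1 (g n))
    (P : Finpartition (Finset.univ : Finset (Fin n))) : ContDiff ℝ 1 (blockProd g P) :=
  contDiff_prod fun X hX =>
    (hg X.card (P.nonempty_of_mem_parts hX).card_pos).comp (contDiff_restr X)

/-- Every label lies in some block, whose factor confines that coordinate to a projection of its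
support. -/
lemma hasCompactSupport_blockProd {g : CorrSeq ν} (hg : ∀ n, 1 ≤ n → HasCompactSupport (g n))
    (P : Finpartition (Finset.univ : Finset (Fin n))) :
    HasCompactSupport (blockProd g P : PhaseN ν n → ℝ) := by
  let K : Fin n → Set (Phase ν) := fun i =>
    ⋃ X ∈ P.parts, ⋃ j : Fin X.card, (fun y : PhaseN ν X.card => y j) '' tsupport (g X.card)
  have hK : ∀ i, IsCompact (K i) := fun i =>
    P.parts.isCompact_biUnion fun X hX => isCompact_iUnion fun j =>
      (hg X.card (P.nonempty_of_mem_parts hX).card_pos).isCompact.image (continuous_apply j)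
  refine HasCompactSupport.intro (isCompact_univ_pi hK) fun x hx => ?_
  by_contra hne
  refine hx fun i _ => ?_
  obtain ⟨Z, hZ, k, rfl⟩ := exists_enum P i
  have h1 : g Z.card (restr Z x) ≠ 0 := fun h => hne (Finset.prod_eq_zero hZ h)
  refine Set.mem_biUnion hZ (Set.mem_iUnion.2 ⟨k, restr Z x, subset_tsupport _ h1, rfl⟩)

lemma IsGlobalFlow.contDiff_comp_neg {V : PhaseN ν n → PhaseN ν n}
    {θ : ℝ → PhaseN ν n → PhaseN ν n} (h : IsGlobalFlow V θ)
    (hV : ContDiff ℝ 1 V) {f : PhaseN ν n → ℝ} (hf : ContDiff ℝ 1 f) :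
    ContDiff ℝ 1 (fun u : ℝ × PhaseN ν n => f (θ (-u.1) u.2)) :=
  hf.comp ((h.contDiff hV).comp (contDiff_fst.neg.prodMk contDiff_snd))

variable (hΦ : AdmissiblePotentials Φ) (hg₀ : ∀ n, 1 ≤ n → IsL10 (g₀ n))
include hΦ hg₀

lemma contDiff_blockProd_clusterSum (Q : Finpartition (Finset.univ : Finset (Fin n))) :
    ContDiff ℝ 1 (fun u : ℝ × PhaseN ν n => blockProd (clusterSum Φ g₀ u.1) Q u.2) := by
  classical
  simp_rw [← sum_blockProd_partitionMove fun n hn => (hg₀ n hn).symm]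
  exact ContDiff.sum fun P _ => (isGlobalFlow_partitionMove hΦ Q).contDiff_comp_neg
    (contDiff_partitionField hΦ Q) (contDiff_blockProd (fun n hn => (hg₀ n hn).smooth) P)

lemma locallyUniformCompactSupport_blockProd_clusterSum
    (Q : Finpartition (Finset.univ : Finset (Fin n))) :
    LocallyUniformCompactSupport (fun t x => blockProd (clusterSum Φ g₀ t) Q x) := by
  classical
  simp_rw [← sum_blockProd_partitionMove fun n hn => (hg₀ n hn).symm]
  refine LocallyUniformCompactSupport.sum fun P _ R => ?_
  obtain ⟨K, hK, h⟩ := (isGlobalFlow_partitionMove hΦ Q).locallyUniformCompactSupport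
    (contDiff_partitionField hΦ Q)
    (hasCompactSupport_blockProd (fun n hn => (hg₀ n hn).compact) P) R
  exact ⟨K, hK, fun t ht => h (-t) (by rwa [abs_neg])⟩

/-- This is a sum of functions transported by one and the same isolated flow, so it solves the
linear Liouville equation of that flow. -/
lemma hasDerivAt_blockProd_clusterSum (Q : Finpartition (Finset.univ : Finset (Fin n))) (t : ℝ)
    (x : PhaseN ν n) : HasDerivAt (fun s => blockProd (clusterSum Φ g₀ s) Q x)
      (-fderiv ℝ (blockProd (clusterSum Φ g₀ t) Q) x (partitionField Φ Q x)) t := by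
  classical
  have hF := isGlobalFlow_partitionMove hΦ Q
  have hV := contDiff_partitionField hΦ Q
  have hb := fun P : Finpartition (Finset.univ : Finset (Fin n)) =>
    contDiff_blockProd (fun n hn => (hg₀ n hn).smooth) P
  have e : ∀ t, blockProd (clusterSum Φ g₀ t) Q = fun x => _ := fun t => funext fun x =>
    (sum_blockProd_partitionMove (fun n hn => (hg₀ n hn).symm) t Q x).symm
  simp_rw [e]
  rw [fderiv_fun_sum (A := fun P y => blockProd g₀ P (partitionMove Φ Q (-t) y)) fun P _ =>
    ((hb P).comp (hF.contDiff_apply hV (-t))).differentiable one_ne_zero x]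
  simp only [sum_apply, ← Finset.sum_neg_distrib]
  exact HasDerivAt.fun_sum fun P _ => hF.hasDerivAt_comp_neg hV (hb P) t x

lemma contDiff_clusterExpansion :
    ContDiff ℝ 1 (fun u : ℝ × PhaseN ν n => clusterExpansion Φ g₀ u.1 n u.2) := by
  simp_rw [clusterExpansion_eq fun n hn => (hg₀ n hn).symm]
  exact ContDiff.sum fun Q _ => contDiff_const.mul (contDiff_blockProd_clusterSum hΦ hg₀ Q)

lemma locallyUniformCompactSupport_clusterExpansion :
    LocallyUniformCompactSupport (fun t (x : PhaseN ν n) => clusterExpansion Φ g₀ t n x) := by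
  simp_rw [clusterExpansion_eq fun n hn => (hg₀ n hn).symm]
  exact LocallyUniformCompactSupport.sum fun Q _ =>
    (locallyUniformCompactSupport_blockProd_clusterSum hΦ hg₀ Q).const_mul _

theorem isL10_clusterExpansion (t : ℝ) (hn : 1 ≤ n) : IsL10 (clusterExpansion Φ g₀ t n) where
  symm := isSymmetricFamily_clusterExpansion hΦ (fun n hn => (hg₀ n hn).symm) t n hn
  smooth := ContDiff.comp (g := fun u : ℝ × PhaseN ν n => clusterExpansion Φ g₀ u.1 n u.2)
    (f := fun x => (t, x)) (contDiff_clusterExpansion hΦ hg₀) (contDiff_prodMk_right t)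
  compact := (locallyUniformCompactSupport_clusterExpansion hΦ hg₀).hasCompactSupport t

omit hΦ hg₀ in
open Classical in
-- Subtract from the Möbius sum over all Q ≥ P the part where a block of `Q` contains `s`. If `P`
-- has one block the two sums are both 1; otherwise the first is 0, and the second is 1 exactly when
-- `s` meets all blocks.
lemma sum_cumulantCoeff_not_interacting (hn : 1 ≤ n)
    (P : Finpartition (Finset.univ : Finset (Fin n))) {s : Finset (Fin n)} (hs : s.Nonempty) :
    (∑ Q : Finpartition (Finset.univ : Finset (Fin n)),
      if P ≤ Q ∧ s ∉ interacting Q then Finpartition.cumulantCoeff Q.parts.card else 0) =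
      if 1 < P.parts.card ∧ s ∈ transversals P then -1 else 0 := by
  have hu : (Finset.univ : Finset (Fin n)).Nonempty :=
    Finset.nonempty_iff_ne_empty.2 (univ_fin_ne_bot hn)
  have h1 := Finpartition.sum_cumulantCoeff hu P
  have h2 := Finpartition.sum_cumulantCoeff_of_subset hu P hs (Finset.subset_univ s)
  rw [Finset.sum_filter] at h1 h2
  have h3 : (∑ Q : Finpartition (Finset.univ : Finset (Fin n)),
      if P ≤ Q ∧ s ∉ interacting Q then Finpartition.cumulantCoeff Q.parts.card else 0) =
      (∑ Q : Finpartition (Finset.univ : Finset (Fin n)),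
        if P ≤ Q then Finpartition.cumulantCoeff Q.parts.card else 0) -
      ∑ Q : Finpartition (Finset.univ : Finset (Fin n)),
        if P ≤ Q ∧ ∃ B ∈ Q.parts, s ⊆ B then Finpartition.cumulantCoeff Q.parts.card else 0 := by
    rw [← Finset.sum_sub_distrib]
    refine Finset.sum_congr rfl fun Q _ => ?_
    by_cases h : P ≤ Q <;> by_cases h' : ∃ B ∈ Q.parts, s ⊆ B <;>
      simp [mem_interacting, h, h', hs]
  rw [h3, h1, h2]
  have hcard : 1 ≤ P.parts.card := Finset.card_pos.2 (P.parts_nonempty hu.ne_empty)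
  simp only [transversals, Finset.mem_filter, Finset.mem_univ, true_and]
  rcases hcard.eq_or_lt with h | h
  · have hP := parts_eq_singleton_of_card_eq_one h.symm
    simp [hP, hs]
  · rw [if_neg h.ne']
    by_cases h' : ∀ X ∈ P.parts, (s ∩ X).Nonempty
    · rw [if_pos h', if_pos ⟨h, h'⟩]
      norm_num
    · rw [if_neg h', if_neg fun h'' => h' h''.2]
      norm_num

omit hΦ hg₀ in
lemma nonempty_of_mem_transversals (hn : 1 ≤ n)
    {P : Finpartition (Finset.univ : Finset (Fin n))} {s : Finset (Fin n)}
    (hs : s ∈ transversals P) : s.Nonempty := by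
  obtain ⟨X, hX⟩ := P.parts_nonempty (univ_fin_ne_bot hn)
  exact ((Finset.mem_filter.1 hs).2 X hX).mono Finset.inter_subset_left

omit hΦ hg₀ in
lemma hamiltonField_eq_partitionField_add (Q : Finpartition (Finset.univ : Finset (Fin n)))
    (x : PhaseN ν n) : hamiltonField Φ x = partitionField Φ Q x +
      ∑ s : Finset (Fin n) with s.Nonempty ∧ s ∉ interacting Q, intField Φ s x := by
  rw [hamiltonField, partitionField, add_assoc]
  congr 1
  have h1 : interacting Q = ((Finset.univ : Finset (Finset (Fin n))).filter
      Finset.Nonempty).filter (fun s => s ∈ interacting Q) := by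
    ext s
    simp only [Finset.mem_filter, Finset.mem_univ, true_and]
    exact ⟨fun h => ⟨(mem_interacting.1 h).1, h⟩, fun h => h.2⟩
  rw [← Finset.filter_filter, ← Finset.sum_filter_add_sum_filter_not
    ((Finset.univ : Finset (Finset (Fin n))).filter Finset.Nonempty) (fun s => s ∈ interacting Q),
    ← h1]

omit hΦ hg₀ in
lemma regroup_sum {A B C : Type*} [Fintype A] [Fintype B] (S : Finset C) (c a : A → ℝ)
    (d : B → C → ℝ) (r : B → C → A → Prop) [∀ b s q, Decidable (r b s q)] :
    ∑ q, c q * -(a q - ∑ b, ∑ s ∈ S, if r b s q then d b s else 0) =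
      -(∑ q, c q * a q) + ∑ b, ∑ s ∈ S, (∑ q, if r b s q then c q else 0) * d b s := by
  have h : ∑ b, ∑ s ∈ S, (∑ q, if r b s q then c q else 0) * d b s =
      ∑ q, c q * ∑ b, ∑ s ∈ S, if r b s q then d b s else 0 := by
    simp_rw [Finset.sum_mul, Finset.mul_sum]
    conv_rhs => rw [Finset.sum_comm]
    refine Finset.sum_congr rfl fun b _ => ?_
    conv_rhs => rw [Finset.sum_comm]
    refine Finset.sum_congr rfl fun q _ => Finset.sum_congr rfl fun s _ => ?_
    split_ifs <;> simp
  rw [h, ← Finset.sum_neg_distrib, ← Finset.sum_add_distrib]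
  exact Finset.sum_congr rfl fun q _ => by ring

/-- The cluster expansion satisfies the hierarchy pointwise. -/
theorem hasDerivAt_clusterExpansion (hn : 1 ≤ n) (t : ℝ) (x : PhaseN ν n) :
    HasDerivAt (fun s => clusterExpansion Φ g₀ s n x)
      (hierarchyRHS Φ (clusterExpansion Φ g₀ t) n x) t := by
  classical
  have hsym : IsSymmetricFamily g₀ := fun n hn => (hg₀ n hn).symm
  have hdg : ∀ P : Finpartition (Finset.univ : Finset (Fin n)),
      Differentiable ℝ (blockProd (clusterExpansion Φ g₀ t) P) := fun P =>
    (contDiff_blockProd (fun m hm => (isL10_clusterExpansion hΦ hg₀ t hm).smooth) P).differentiable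
      one_ne_zero
  have hG : ∀ Q : Finpartition (Finset.univ : Finset (Fin n)),
      Differentiable ℝ (blockProd (clusterSum Φ g₀ t) Q) := fun Q =>
    (ContDiff.comp (g := fun u : ℝ × PhaseN ν n => blockProd (clusterSum Φ g₀ u.1) Q u.2)
      (f := fun x => (t, x)) (contDiff_blockProd_clusterSum hΦ hg₀ Q)
      (contDiff_prodMk_right t)).differentiable one_ne_zero
  have hDG : ∀ Q : Finpartition (Finset.univ : Finset (Fin n)),
      fderiv ℝ (blockProd (clusterSum Φ g₀ t) Q) x =
        ∑ P : Finpartition (Finset.univ : Finset (Fin n)) with P ≤ Q,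
          fderiv ℝ (blockProd (clusterExpansion Φ g₀ t) P) x := fun Q => by
    have e : blockProd (clusterSum Φ g₀ t) Q = fun x => _ := funext fun x =>
      (sum_blockProd_clusterExpansion hΦ hsym t Q x).symm
    rw [e, fderiv_fun_sum fun P _ => hdg P x]
  have hDg : fderiv ℝ (clusterExpansion Φ g₀ t n) x =
      ∑ Q : Finpartition (Finset.univ : Finset (Fin n)),
        Finpartition.cumulantCoeff Q.parts.card • fderiv ℝ (blockProd (clusterSum Φ g₀ t) Q) x := by
    have e : clusterExpansion Φ g₀ t n = fun x => _ := funext fun x => clusterExpansion_eq hsym t x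
    rw [e, fderiv_fun_sum fun Q _ => ((hG Q) x).const_mul _]
    exact Finset.sum_congr rfl fun Q _ => fderiv_const_mul ((hG Q) x) _
  have hder : HasDerivAt (fun s => clusterExpansion Φ g₀ s n x)
      (∑ Q : Finpartition (Finset.univ : Finset (Fin n)), Finpartition.cumulantCoeff Q.parts.card *
        -fderiv ℝ (blockProd (clusterSum Φ g₀ t) Q) x (partitionField Φ Q x)) t := by
    simp_rw [clusterExpansion_eq hsym]
    exact HasDerivAt.fun_sum fun Q _ => (hasDerivAt_blockProd_clusterSum hΦ hg₀ Q t x).const_mul _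
  convert hder using 1
  -- The isolated field is the full one minus the interactions cut by `Q`; by `hDG` each missing
  -- interaction acts on the block products of the evolved expansion.
  have hQ : ∀ Q : Finpartition (Finset.univ : Finset (Fin n)),
      fderiv ℝ (blockProd (clusterSum Φ g₀ t) Q) x (partitionField Φ Q x) =
        fderiv ℝ (blockProd (clusterSum Φ g₀ t) Q) x (hamiltonField Φ x) -
        ∑ P : Finpartition (Finset.univ : Finset (Fin n)),
          ∑ s : Finset (Fin n) with s.Nonempty, if P ≤ Q ∧ s ∉ interacting Q then
            liouvilleInt Φ s (blockProd (clusterExpansion Φ g₀ t) P) x else 0 := fun Q => by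
    rw [hamiltonField_eq_partitionField_add Q, map_add, map_sum, add_sub_assoc, left_eq_add,
      sub_eq_zero, Finset.sum_comm, ← Finset.filter_filter, Finset.sum_filter]
    refine Finset.sum_congr rfl fun s _ => ?_
    split_ifs with h
    · simp [h]
    · rw [hDG, sum_apply, Finset.sum_filter]
      refine Finset.sum_congr rfl fun P _ => ?_
      simp only [h, not_false_eq_true, and_true, fderiv_intField (hdg P x)]
  simp_rw [hQ]
  -- The full field now gives the linear term, and every cut interaction carries a sum of
  -- coefficients over `Q` that Möbius inversion evaluates.
  rw [regroup_sum, hierarchyRHS]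
  congr 1
  · rw [← fderiv_hamiltonField ((isL10_clusterExpansion hΦ hg₀ t hn).smooth.differentiable
      one_ne_zero x), hDg, sum_apply]
    rfl
  · rw [Finset.sum_filter]
    refine Finset.sum_congr rfl fun P _ => ?_
    symm
    rw [Finset.sum_congr rfl fun s hs => congrArg
      (· * liouvilleInt Φ s (blockProd (clusterExpansion Φ g₀ t) P) x)
      (sum_cumulantCoeff_not_interacting hn P (Finset.mem_filter.1 hs).2)]
    by_cases hP : 1 < P.parts.card
    · simp only [hP, true_and, if_true, ite_mul, zero_mul, neg_mul, one_mul]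
      rw [← Finset.sum_filter, Finset.filter_filter]
      refine Finset.sum_congr ?_ fun _ _ => rfl
      ext s
      simp only [Finset.mem_filter, Finset.mem_univ, true_and]
      exact ⟨fun h => h.2, fun h => ⟨nonempty_of_mem_transversals hn h, h⟩⟩
    · simp [hP]

end Regularity

/-! ### Uniqueness for weak transport equations -/

section WeakUniqueness
variable {E : Type*} [NormedAddCommGroup E] [NormedSpace ℝ E]
  [MeasurableSpace E] [BorelSpace E] {μ : Measure E}

omit [NormedSpace ℝ E] in
lemma integrable_L1_mul [SecondCountableTopology E] (f : Lp ℝ 1 μ) {χ : E → ℝ}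
    (hχ : Continuous χ) {C : ℝ} (hC : ∀ x, ‖χ x‖ ≤ C) : Integrable (fun x => f x * χ x) μ :=
  (L1.integrable_coeFn f).mul_bdd hχ.aestronglyMeasurable (.of_forall hC)

omit [NormedSpace ℝ E] in
lemma integrable_L1_mul_of_hasCompactSupport [SecondCountableTopology E] (f : Lp ℝ 1 μ)
    {χ : E → ℝ} (hχ : Continuous χ) (hs : HasCompactSupport χ) :
    Integrable (fun x => f x * χ x) μ := by
  obtain ⟨C, hC⟩ := hχ.bounded_above_of_compact_support hs
  exact integrable_L1_mul f hχ hC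

/-- The pairing of integrable and bounded continuous functions. -/
def pairing [SecondCountableTopology E] (μ : Measure E) :
    Lp ℝ 1 μ →L[ℝ] BoundedContinuousFunction E ℝ →L[ℝ] ℝ :=
  LinearMap.mkContinuous₂
    (LinearMap.mk₂ ℝ (fun (f : Lp ℝ 1 μ) (χ : BoundedContinuousFunction E ℝ) => ∫ x, f x * χ x ∂μ)
      (fun f f' χ => by
        rw [← integral_add (integrable_L1_mul f χ.continuous χ.norm_coe_le_norm)
          (integrable_L1_mul f' χ.continuous χ.norm_coe_le_norm)]
        refine integral_congr_ae ?_
        filter_upwards [Lp.coeFn_add f f'] with x hx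
        rw [hx, Pi.add_apply, add_mul])
      (fun c f χ => by
        rw [smul_eq_mul, ← integral_const_mul]
        refine integral_congr_ae ?_
        filter_upwards [Lp.coeFn_smul c f] with x hx
        rw [hx, Pi.smul_apply, smul_eq_mul, mul_assoc])
      (fun f χ χ' => by
        rw [← integral_add (integrable_L1_mul f χ.continuous χ.norm_coe_le_norm)
          (integrable_L1_mul f χ'.continuous χ'.norm_coe_le_norm)]
        simp [mul_add])
      (fun c f χ => by
        rw [smul_eq_mul, ← integral_const_mul]
        refine integral_congr_ae (.of_forall fun x => ?_)
        simp only [BoundedContinuousFunction.coe_smul, smul_eq_mul]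
        ring)) 1 (fun f χ => by
    rw [one_mul, L1.norm_eq_integral_norm, LinearMap.mk₂_apply, ← integral_mul_const]
    refine norm_integral_le_of_norm_le ((L1.integrable_coeFn f).norm.mul_const _)
      (.of_forall fun x => ?_)
    rw [norm_mul]
    exact mul_le_mul_of_nonneg_left (χ.norm_coe_le_norm x) (norm_nonneg _))

omit [NormedSpace ℝ E] in
lemma pairing_apply [SecondCountableTopology E] (f : Lp ℝ 1 μ)
    (χ : BoundedContinuousFunction E ℝ) : pairing μ f χ = ∫ x, f x * χ x ∂μ := rfl

omit [NormedSpace ℝ E] [MeasurableSpace E] [BorelSpace E] in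
lemma exists_boundedContinuousFunction {χ : E → ℝ} (hχ : Continuous χ)
    (hs : HasCompactSupport χ) : ∃ Ψ : BoundedContinuousFunction E ℝ, ∀ x, Ψ x = χ x := by
  obtain ⟨C, hC⟩ := hχ.bounded_above_of_compact_support hs
  exact ⟨BoundedContinuousFunction.ofNormedAddCommGroup χ hχ C hC, fun _ => rfl⟩

/-- Weak solutions of the transport equation along a complete `C¹` field are unique. -/
theorem IsGlobalFlow.eq_zero_of_weak_transport [FiniteDimensional ℝ E]
    [IsFiniteMeasureOnCompacts μ] {V : E → E} {θ : ℝ → E → E}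
    (h : IsGlobalFlow V θ) (hV : ContDiff ℝ 1 V) {w w' : ℝ → Lp ℝ 1 μ}
    (hw : ∀ t, HasDerivAt w (w' t) t)
    (hweak : ∀ t (ψ : E → ℝ), ContDiff ℝ 1 ψ → HasCompactSupport ψ →
      ∫ x, w' t x * ψ x ∂μ = ∫ x, w t x * fderiv ℝ ψ x (V x) ∂μ)
    (h0 : w 0 = 0) (T : ℝ) : w T = 0 := by
  have : ProperSpace E := FiniteDimensional.proper ℝ E
  have : SecondCountableTopology E := inferInstance
  have key : ∀ ψ : E → ℝ, ContDiff ℝ 1 ψ → HasCompactSupport ψ → ∫ x, w T x * ψ x ∂μ = 0 := by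
    intro ψ hψ hs
    -- Duality: the test function `ψ ∘ θ (T - s)` solves the adjoint equation and equals `ψ` at `s =
    -- T`, so its pairing with `w s` is constant in `s`.
    have hc : ContDiff ℝ 1 (fun u : ℝ × E => ψ (θ (T - u.1) u.2)) :=
      hψ.comp ((h.contDiff hV).comp ((contDiff_const.sub contDiff_fst).prodMk contDiff_snd))
    have hcs : ∀ s, ContDiff ℝ 1 (fun x => ψ (θ (T - s) x)) := fun s =>
      hψ.comp (h.contDiff_apply hV _)
    have hls : LocallyUniformCompactSupport (fun s x => ψ (θ (T - s) x)) := fun R => by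
      obtain ⟨K, hK, hK'⟩ := h.locallyUniformCompactSupport hV hs (|T| + R)
      exact ⟨K, hK, fun t ht => hK' _ ((abs_sub _ _).trans (by linarith))⟩
    have hd : ∀ s x, HasDerivAt (fun s => ψ (θ (T - s) x))
        (-fderiv ℝ (fun y => ψ (θ (T - s) y)) x (V x)) s := fun s x => by
      simpa [Function.comp_def] using
        (h.hasDerivAt_comp hV hψ (T - s) x).scomp s ((hasDerivAt_id s).const_sub T)
    choose Ψ hΨ using fun s => exists_boundedContinuousFunction (hcs s).continuous
      (hls.hasCompactSupport s)
    choose Ψ' hΨ' using fun s => exists_boundedContinuousFunction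
      (continuous_fderiv_field hV.continuous (hcs s)).neg
      (hasCompactSupport_fderiv_field (V := V) (hls.hasCompactSupport s)).neg
    have hder : ∀ s, HasDerivAt (fun s => pairing μ (w s) (Ψ s)) 0 s := fun s => by
      have h1 := (pairing μ).hasDerivAt_of_bilinear (fun _ => hw s)
        (fun _ => hasDerivAt_boundedContinuousFunction hc hls hd hΨ (hΨ' s))
      have h2 := hweak s _ (hcs s) (hls.hasCompactSupport s)
      rw [pairing_apply, pairing_apply] at h1
      simp only [hΨ', hΨ, Pi.neg_apply, mul_neg, integral_neg] at h1
      rwa [h2, neg_add_cancel] at h1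
    have h1 := is_const_of_deriv_eq_zero (fun s => (hder s).differentiableAt)
      (fun s => (hder s).deriv) T 0
    rw [h0, map_zero, zero_apply, pairing_apply] at h1
    simpa [hΨ, h.zero] using h1
  refine (Lp.eq_zero_iff_ae_eq_zero).2 ?_
  refine ae_eq_zero_of_integral_contDiff_smul_eq_zero
    (L1.integrable_coeFn (w T)).locallyIntegrable fun ψ hψ hs => ?_
  simp only [smul_eq_mul, mul_comm (ψ _)]
  exact key ψ (hψ.of_le (by exact_mod_cast le_top)) hs

end WeakUniqueness

/-! ### Splitting the phase space along the blocks of a partition -/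

section Fubini
variable {ν n : ℕ}

/-- The labels are enumerated by the blocks of a partition and the positions in the blocks. -/
def blockEquiv (P : Finpartition (Finset.univ : Finset (Fin n))) :
    (Σ X : P.parts, Fin X.1.card) ≃ Fin n :=
  Equiv.ofBijective (fun a => enum a.1.1 a.2) (by
    constructor
    · rintro ⟨⟨X, hX⟩, j⟩ ⟨⟨Y, hY⟩, k⟩ h
      obtain rfl := P.eq_of_mem_parts hX hY (X.orderEmbOfFin_mem rfl j)
        (by rw [show X.orderEmbOfFin rfl j = enum Y k from h]; exact Y.orderEmbOfFin_mem rfl k)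
      obtain rfl := (enum X).injective h
      rfl
    · intro i
      obtain ⟨Z, hZ, k, hk⟩ := exists_enum P i
      exact ⟨⟨⟨Z, hZ⟩, k⟩, hk⟩)

/-- The inverse `S` reassembles a point from its blocks. It pulls boxes back to boxes with the same
factors, hence preserves the product measure. -/
lemma measurePreserving_restr (P : Finpartition (Finset.univ : Finset (Fin n))) :
    MeasurePreserving (fun (x : PhaseN ν n) (X : P.parts) => restr X.1 x) volume volume := by
  let S : ((X : P.parts) → PhaseN ν X.1.card) → PhaseN ν n := fun y i =>
    y ((blockEquiv P).symm i).1 ((blockEquiv P).symm i).2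
  have hSm : Measurable S := measurable_pi_lambda _ fun i =>
    (measurable_pi_apply _).comp (measurable_pi_apply _)
  have hTm : Measurable (fun (x : PhaseN ν n) (X : P.parts) => restr X.1 x) :=
    measurable_pi_lambda _ fun X => measurable_pi_lambda _ fun j => measurable_pi_apply _
  have hTS : (fun (x : PhaseN ν n) (X : P.parts) => restr X.1 x) ∘ S = id := by
    funext y X j
    have h : (blockEquiv P).symm (enum X.1 j) = ⟨X, j⟩ := (Equiv.symm_apply_eq _).2 rfl
    change y ((blockEquiv P).symm (enum X.1 j)).1 ((blockEquiv P).symm (enum X.1 j)).2 = y X j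
    rw [h]
  have hS : volume = Measure.map S volume := by
    refine Measure.pi_eq fun B hB => ?_
    rw [Measure.map_apply hSm (MeasurableSet.univ_pi hB)]
    have hpre : S ⁻¹' Set.univ.pi B = Set.univ.pi fun X : P.parts =>
        Set.univ.pi fun j : Fin X.1.card => B (blockEquiv P ⟨X, j⟩) := by
      ext y
      simp only [Set.mem_preimage, Set.mem_univ_pi]
      constructor
      · intro h X j
        have := h (blockEquiv P ⟨X, j⟩)
        rwa [show S y (blockEquiv P ⟨X, j⟩) = y X j from congrFun (congrFun (congrFun hTS y) X) j]
          at this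
      · intro h i
        have := h ((blockEquiv P).symm i).1 ((blockEquiv P).symm i).2
        simpa using this
    rw [hpre, volume_pi, Measure.pi_pi]
    simp_rw [volume_pi, Measure.pi_pi]
    rw [← (blockEquiv P).prod_comp, Fintype.prod_sigma]
  refine ⟨hTm, ?_⟩
  nth_rw 1 [hS]
  rw [Measure.map_map hTm hSm, hTS, Measure.map_id]

/-- Null sets in the variables of a block pull back to null sets, so block products of `L¹` classes
do not depend on the representatives up to null sets. -/
lemma quasiMeasurePreserving_restr {P : Finpartition (Finset.univ : Finset (Fin n))}
    {X : Finset (Fin n)} (hX : X ∈ P.parts) :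
    Measure.QuasiMeasurePreserving (restr X : PhaseN ν n → PhaseN ν X.card) volume volume :=
  (Measure.quasiMeasurePreserving_eval (fun X : P.parts => (volume : Measure (PhaseN ν X.1.card)))
    ⟨X, hX⟩).comp (measurePreserving_restr P).quasiMeasurePreserving

lemma blockProd_congr_ae {g g' : CorrSeq ν} (h : ∀ m, 1 ≤ m → g m =ᵐ[volume] g' m)
    (P : Finpartition (Finset.univ : Finset (Fin n))) :
    blockProd g P =ᵐ[volume] blockProd g' P := by
  have h1 : ∀ᵐ x : PhaseN ν n, ∀ X ∈ P.parts, g X.card (restr X x) = g' X.card (restr X x) :=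
    (Filter.eventually_all_finset _).2 fun X hX =>
      (quasiMeasurePreserving_restr hX).ae (h X.card (P.nonempty_of_mem_parts hX).card_pos)
  filter_upwards [h1] with x hx
  exact Finset.prod_congr rfl hx

lemma integral_abs_blockProd {g : CorrSeq ν} (hg : ∀ m, 1 ≤ m → Continuous (g m))
    (P : Finpartition (Finset.univ : Finset (Fin n))) :
    ∫ x, |blockProd g P x| = ∏ X ∈ P.parts, ∫ x, |g X.card x| := by
  have h1 : ∀ x : PhaseN ν n, |blockProd g P x| =
      (fun y : (X : P.parts) → PhaseN ν X.1.card => ∏ X, |g X.1.card (y X)|)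
        (fun X : P.parts => restr X.1 x) := fun x => by
    rw [blockProd, Finset.abs_prod, ← Finset.prod_coe_sort]
  simp_rw [h1]
  have hc : Continuous (fun y : (X : P.parts) → PhaseN ν X.1.card => ∏ X, |g X.1.card (y X)|) :=
    continuous_finsetProd _ fun X _ =>
      ((hg _ (P.nonempty_of_mem_parts X.2).card_pos).comp (continuous_apply X)).abs
  rw [← integral_map (measurePreserving_restr P).measurable.aemeasurable
    hc.aestronglyMeasurable, (measurePreserving_restr P).map_eq,
    integral_fintype_prod_volume_eq_prod (fun (X : P.parts) y => |g X.1.card y|),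
    Finset.prod_coe_sort P.parts (fun X => ∫ x, |g X.card x|)]

end Fubini

/-! ### Distributional form of the hierarchy and uniqueness -/

section WeakForm
variable {ν n : ℕ} {Φ : Potentials ν}

lemma integral_liouville_mul (hΦ : AdmissiblePotentials Φ) {f ψ : PhaseN ν n → ℝ}
    (hf : ContDiff ℝ 1 f) (hψ : ContDiff ℝ 1 ψ) (hs : HasCompactSupport ψ) :
    ∫ x, liouville Φ f x * ψ x = -∫ x, f x * liouville Φ ψ x := by
  simp_rw [← fderiv_hamiltonField (hf.differentiable one_ne_zero _),
    ← fderiv_hamiltonField (hψ.differentiable one_ne_zero _)]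
  exact (isDivergenceFree_hamiltonField hΦ).integral_fderiv_mul hf hψ hs

lemma integral_liouvilleInt_mul (hΦ : AdmissiblePotentials Φ) {s : Finset (Fin n)}
    (hne : s.Nonempty) {f ψ : PhaseN ν n → ℝ}
    (hf : ContDiff ℝ 1 f) (hψ : ContDiff ℝ 1 ψ) (hs : HasCompactSupport ψ) :
    ∫ x, liouvilleInt Φ s f x * ψ x = -∫ x, f x * liouvilleInt Φ s ψ x := by
  simp_rw [← fderiv_intField (hf.differentiable one_ne_zero _),
    ← fderiv_intField (hψ.differentiable one_ne_zero _)]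
  exact (isDivergenceFree_intField hΦ hne).integral_fderiv_mul hf hψ hs

lemma continuous_liouville (hΦ : AdmissiblePotentials Φ) {f : PhaseN ν n → ℝ}
    (hf : ContDiff ℝ 1 f) : Continuous (liouville Φ f) := by
  have h := continuous_fderiv_field (contDiff_hamiltonField hΦ).continuous hf
  simpa only [fderiv_hamiltonField (hf.differentiable one_ne_zero _)] using h

lemma continuous_liouvilleInt (hΦ : AdmissiblePotentials Φ) {s : Finset (Fin n)}
    (hne : s.Nonempty) {f : PhaseN ν n → ℝ} (hf : ContDiff ℝ 1 f) :
    Continuous (liouvilleInt Φ s f) := by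
  have h := continuous_fderiv_field (contDiff_intField hΦ hne).continuous hf
  simpa only [fderiv_intField (hf.differentiable one_ne_zero _)] using h

/-- Classical solutions are solutions in the sense of distributions. -/
lemma integral_hierarchyRHS_mul (hΦ : AdmissiblePotentials Φ) (hn : 1 ≤ n) {g : CorrSeq ν}
    (hg : ∀ m, 1 ≤ m → ContDiff ℝ 1 (g m)) {ψ : PhaseN ν n → ℝ} (hψ : ContDiff ℝ 1 ψ)
    (hs : HasCompactSupport ψ) :
    ∫ x, hierarchyRHS Φ g n x * ψ x = (∫ x, g n x * liouville Φ ψ x) +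
      ∑ P : Finpartition (Finset.univ : Finset (Fin n)) with 1 < P.parts.card,
        ∑ s ∈ transversals P, ∫ x, blockProd g P x * liouvilleInt Φ s ψ x := by
  have hint : ∀ {f : PhaseN ν n → ℝ}, Continuous f → Integrable (fun x => f x * ψ x) :=
    fun hf => (hf.mul hψ.continuous).integrable_of_hasCompactSupport hs.mul_left
  have h1 : ∀ P : Finpartition (Finset.univ : Finset (Fin n)), ∀ s ∈ transversals P,
      Integrable (fun x => -liouvilleInt Φ s (blockProd g P) x * ψ x) := fun P s hs' =>
    hint (continuous_liouvilleInt hΦ (nonempty_of_mem_transversals hn hs')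
      (contDiff_blockProd hg P)).neg
  have h2 : Integrable (fun x => -liouville Φ (g n) x * ψ x) :=
    hint (continuous_liouville hΦ (hg n hn)).neg
  simp only [hierarchyRHS, add_mul, Finset.sum_mul]
  rw [integral_add h2 (integrable_finsetSum _ fun P _ => integrable_finsetSum _ (h1 P)),
    integral_finsetSum _ fun P _ => integrable_finsetSum _ (h1 P)]
  simp only [neg_mul]
  rw [integral_neg, integral_liouville_mul hΦ (hg n hn) hψ hs, neg_neg]
  congr 1
  refine Finset.sum_congr rfl fun P _ => ?_
  rw [integral_finsetSum _ fun s hs' => by simpa only [neg_mul] using h1 P s hs']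
  refine Finset.sum_congr rfl fun s hs' => ?_
  rw [integral_neg, integral_liouvilleInt_mul hΦ (nonempty_of_mem_transversals hn hs')
    (contDiff_blockProd hg P) hψ hs, neg_neg]

/-- Makes the hierarchy triangular: the nonlinear terms at level `n` involve lower levels only. -/
lemma card_lt_of_mem_parts {P : Finpartition (Finset.univ : Finset (Fin n))}
    (hP : 1 < P.parts.card) {X : Finset (Fin n)} (hX : X ∈ P.parts) : X.card < n := by
  obtain ⟨Y, hY, hYX⟩ := Finset.exists_mem_ne hP X
  obtain ⟨i, hi⟩ := P.nonempty_of_mem_parts hY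
  have hss : X ⊂ Finset.univ := Finset.ssubset_univ_iff.2 fun h =>
    hYX (P.eq_of_mem_parts hY hX hi (h ▸ Finset.mem_univ i))
  simpa using Finset.card_lt_card hss

/-- Strong solutions are determined by their initial data. -/
theorem IsStrongSolution.eq_of_initial_eq (hΦ : AdmissiblePotentials Φ)
    {u v : ℝ → (n : ℕ) → L1 ν n} (hu : IsStrongSolution Φ u) (hv : IsStrongSolution Φ v)
    (h0 : ∀ n, 1 ≤ n → u 0 n = v 0 n) (n : ℕ) : 1 ≤ n → ∀ t, u t n = v t n := by
  induction n using Nat.strong_induction_on with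
  | _ n ih =>
  intro hn t
  choose u' hu' hueq using fun t => hu.eqn t n hn
  choose v' hv' hveq using fun t => hv.eqn t n hn
  -- The nonlinear terms coincide by induction, so they cancel in the difference, which then
  -- satisfies the linear equation weakly.
  have hprod : ∀ t (P : Finpartition (Finset.univ : Finset (Fin n))), 1 < P.parts.card →
      blockProd (fun m => ⇑(u t m)) P = blockProd (fun m => ⇑(v t m)) P := by
    intro t P hP
    funext x
    refine Finset.prod_congr rfl fun X hX => ?_
    change u t X.card (restr X x) = v t X.card (restr X x)
    rw [ih X.card (card_lt_of_mem_parts hP hX) (P.nonempty_of_mem_parts hX).card_pos t]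
  have hsub : ∀ (f f' : L1 ν n) {ψ : PhaseN ν n → ℝ}, Continuous ψ → HasCompactSupport ψ →
      ∫ x, (f - f') x * ψ x = (∫ x, f x * ψ x) - ∫ x, f' x * ψ x := by
    intro f f' ψ hψ hs
    rw [← integral_sub (integrable_L1_mul_of_hasCompactSupport f hψ hs)
      (integrable_L1_mul_of_hasCompactSupport f' hψ hs)]
    refine integral_congr_ae ?_
    filter_upwards [Lp.coeFn_sub f f'] with x hx
    rw [hx, Pi.sub_apply, sub_mul]
  refine sub_eq_zero.1 ((isGlobalFlow_hamiltonFlow hΦ hn).eq_zero_of_weak_transport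
    (contDiff_hamiltonField hΦ) (μ := volume) (w := fun t => u t n - v t n)
    (w' := fun t => u' t - v' t) (fun t => (hu' t).sub (hv' t)) (fun t ψ hψ hs => ?_)
    (sub_eq_zero.2 (h0 n hn)) t)
  rw [hsub _ _ hψ.continuous hs, hueq t ψ hψ hs, hveq t ψ hψ hs,
    hsub _ _ (continuous_fderiv_field (contDiff_hamiltonField hΦ).continuous hψ)
      (hasCompactSupport_fderiv_field hs)]
  simp only [fderiv_hamiltonField (hψ.differentiable one_ne_zero _)]
  rw [Finset.sum_congr rfl fun P hP => by rw [hprod t P (Finset.mem_filter.1 hP).2]]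
  ring

end WeakForm

/-! ### The cluster expansion as the strong solution -/

section Expansion
variable {ν n : ℕ} {Φ : Potentials ν} {g₀ : CorrSeq ν}

/-- At time 0 nothing moves, and the logarithm of the exponential of the data is the data. -/
lemma clusterExpansion_zero (hΦ : AdmissiblePotentials Φ) (hg₀ : IsSymmetricFamily g₀)
    (hn : 1 ≤ n) (x : PhaseN ν n) : clusterExpansion Φ g₀ 0 n x = g₀ n x := by
  classical
  rw [clusterExpansion_eq hg₀, ← labelled_univ hg₀ hn,
    ← partitionLog_partitionExp (labelled g₀ x) (Finset.nonempty_iff_ne_empty.2 (univ_fin_ne_bot hn))]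
  refine Finset.sum_congr rfl fun Q _ => ?_
  rw [← sum_blockProd_partitionMove hg₀, prod_partitionExp]
  simp only [neg_zero, (isGlobalFlow_partitionMove hΦ Q).zero]
  rfl

lemma measurePreserving_comp_perm (σ : Equiv.Perm (Fin n)) :
    MeasurePreserving (fun x : PhaseN ν n => x ∘ σ) volume volume :=
  volume_preserving_arrowCongr' σ.symm (MeasurableEquiv.refl (Phase ν))
    (MeasurePreserving.id volume)

/-- The norm estimate for cumulants. -/
lemma integral_abs_clusterExpansion_le (hΦ : AdmissiblePotentials Φ)
    (hg₀ : ∀ n, 1 ≤ n → IsL10 (g₀ n)) (hn : 1 ≤ n) (t : ℝ) :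
    ∫ x, |clusterExpansion Φ g₀ t n x| ≤ (n ! : ℝ) * Real.exp (n + 1) *
      ∑ P : Finpartition (Finset.univ : Finset (Fin n)), ∏ X ∈ P.parts, ∫ x, |g₀ X.card x| := by
  classical
  have hb := contDiff_blockProd (n := n) fun n hn => (hg₀ n hn).smooth
  have hc := hasCompactSupport_blockProd (n := n) fun n hn => (hg₀ n hn).compact
  have hI : ∀ P Q : Finpartition (Finset.univ : Finset (Fin n)),
      Integrable (fun x => blockProd g₀ P (partitionMove Φ Q (-t) x)) := fun P Q =>
    (((hb P).comp ((isGlobalFlow_partitionMove hΦ Q).contDiff_apply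
      (contDiff_partitionField hΦ Q) (-t))).continuous).integrable_of_hasCompactSupport
      (((isGlobalFlow_partitionMove hΦ Q).locallyUniformCompactSupport
        (contDiff_partitionField hΦ Q) (hc P)).hasCompactSupport (-t))
  -- The isolated flow preserves the `L¹` norm and Fubini factorises it, so the norm no longer
  -- depends on `Q` and only the factorials remain to be summed.
  have hE : ∀ P Q : Finpartition (Finset.univ : Finset (Fin n)),
      ∫ x, |blockProd g₀ P (partitionMove Φ Q (-t) x)| = ∏ X ∈ P.parts, ∫ x, |g₀ X.card x| :=
    fun P Q => by
      rw [(isGlobalFlow_partitionMove hΦ Q).integral_abs_comp (contDiff_partitionField hΦ Q)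
        (isDivergenceFree_partitionField hΦ Q) (hb P) (hc P),
        integral_abs_blockProd fun m hm => (hg₀ m hm).smooth.continuous]
  have hle : ∀ x : PhaseN ν n, |clusterExpansion Φ g₀ t n x| ≤
      ∑ P : Finpartition (Finset.univ : Finset (Fin n)),
        ∑ Q : Finpartition (Finset.univ : Finset (Fin n)) with P ≤ Q,
          ((Q.parts.card - 1)! : ℝ) * |blockProd g₀ P (partitionMove Φ Q (-t) x)| := fun x => by
    refine (Finset.abs_sum_le_sum_abs _ _).trans (Finset.sum_le_sum fun P _ => ?_)
    refine (Finset.abs_sum_le_sum_abs _ _).trans (le_of_eq ?_)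
    refine Finset.sum_congr ?_ fun Q _ => ?_
    · ext; simp
    · simp [abs_mul]
  have hJ : ∀ P Q : Finpartition (Finset.univ : Finset (Fin n)), Integrable fun x =>
      ((Q.parts.card - 1)! : ℝ) * |blockProd g₀ P (partitionMove Φ Q (-t) x)| :=
    fun P Q => (hI P Q).abs.const_mul _
  refine (integral_mono_of_nonneg (.of_forall fun _ => abs_nonneg _)
    (integrable_finsetSum _ fun P _ => integrable_finsetSum _ fun Q _ => hJ P Q)
    (.of_forall hle)).trans ?_
  rw [integral_finsetSum _ fun P _ => integrable_finsetSum _ fun Q _ => hJ P Q, Finset.mul_sum]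
  refine Finset.sum_le_sum fun P _ => ?_
  rw [integral_finsetSum _ fun Q _ => hJ P Q]
  simp_rw [integral_const_mul, hE]
  rw [← Finset.sum_mul]
  refine mul_le_mul_of_nonneg_right ?_ (Finset.prod_nonneg fun X _ =>
    integral_nonneg fun _ => abs_nonneg _)
  have h := Finpartition.sum_factorial_card_le P
    (Finset.nonempty_iff_ne_empty.2 (univ_fin_ne_bot hn))
  rw [Finset.card_univ, Fintype.card_fin] at h
  exact h

open Classical in
/-- The cluster expansion as a path in the spaces of integrable functions. -/
def clusterSolution (Φ : Potentials ν) (g₀ : CorrSeq ν) (t : ℝ) (n : ℕ) : L1 ν n :=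
  if h : Integrable (clusterExpansion Φ g₀ t n) volume then h.toL1 else 0

lemma coeFn_clusterSolution (hΦ : AdmissiblePotentials Φ) (hg₀ : ∀ n, 1 ≤ n → IsL10 (g₀ n))
    (t : ℝ) (hn : 1 ≤ n) : clusterSolution Φ g₀ t n =ᵐ[volume] clusterExpansion Φ g₀ t n := by
  have hL := isL10_clusterExpansion hΦ hg₀ t hn
  have h := hL.smooth.continuous.integrable_of_hasCompactSupport hL.compact (μ := volume)
  rw [clusterSolution, dif_pos h]
  exact h.coeFn_toL1

lemma exists_hasDerivAt_clusterSolution (hΦ : AdmissiblePotentials Φ)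
    (hg₀ : ∀ n, 1 ≤ n → IsL10 (g₀ n)) (t : ℝ) (hn : 1 ≤ n) :
    ∃ v : L1 ν n, HasDerivAt (fun s => clusterSolution Φ g₀ s n) v t ∧
      v =ᵐ[volume] hierarchyRHS Φ (clusterExpansion Φ g₀ t) n := by
  have hd := hasDerivAt_clusterExpansion hΦ hg₀ hn
  have hs := locallyUniformCompactSupport_clusterExpansion (n := n) hΦ hg₀
  have hh := contDiff_clusterExpansion (n := n) hΦ hg₀
  -- As the time derivative of a jointly C¹ function with locally uniform compact support, the
  -- right-hand side is continuous with compact support.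
  have hI : Integrable (hierarchyRHS Φ (clusterExpansion Φ g₀ t) n) volume :=
    ((continuous_of_hasDerivAt_slice hh hd).comp
      (Continuous.prodMk_right t)).integrable_of_hasCompactSupport
      ((hs.of_hasDerivAt hd).hasCompactSupport t)
  exact ⟨hI.toL1, hasDerivAt_L1 hh hs hd (fun s => coeFn_clusterSolution hΦ hg₀ s hn)
    hI.coeFn_toL1, hI.coeFn_toL1⟩

theorem isStrongSolution_clusterSolution (hΦ : AdmissiblePotentials Φ)
    (hg₀ : ∀ n, 1 ≤ n → IsL10 (g₀ n)) : IsStrongSolution Φ (clusterSolution Φ g₀) where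
  symm t n hn σ := by
    have h := coeFn_clusterSolution hΦ hg₀ t hn
    filter_upwards [h, (measurePreserving_comp_perm σ).quasiMeasurePreserving.ae h] with x h1 h2
    rw [h1, h2, (isL10_clusterExpansion hΦ hg₀ t hn).symm]
  eqn t n hn := by
    obtain ⟨v, hv, hv'⟩ := exists_hasDerivAt_clusterSolution hΦ hg₀ t hn
    refine ⟨v, hv, fun ψ hψ hs => ?_⟩
    have h1 := integral_hierarchyRHS_mul hΦ hn
      (fun m hm => (isL10_clusterExpansion hΦ hg₀ t hm).smooth) hψ hs
    have h2 : ∫ x, v x * ψ x = ∫ x, hierarchyRHS Φ (clusterExpansion Φ g₀ t) n x * ψ x :=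
      integral_congr_ae (hv'.mono fun x hx => by simp only [hx])
    have h3 : ∫ x, clusterSolution Φ g₀ t n x * liouville Φ ψ x =
        ∫ x, clusterExpansion Φ g₀ t n x * liouville Φ ψ x :=
      integral_congr_ae ((coeFn_clusterSolution hΦ hg₀ t hn).mono fun x hx => by simp only [hx])
    rw [h2, h1, h3]
    congr 1
    refine Finset.sum_congr rfl fun P _ => Finset.sum_congr rfl fun s _ => integral_congr_ae ?_
    filter_upwards [blockProd_congr_ae (g := fun m => ⇑(clusterSolution Φ g₀ t m))
      (fun m hm => coeFn_clusterSolution hΦ hg₀ t hm) P] with x hx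
    rw [hx]

end Expansion

end

theorem theorem1 (ν : ℕ) (hν : 1 ≤ ν) (Φ : Potentials ν) (hΦ : AdmissiblePotentials Φ)
    (g₀ : CorrSeq ν) (hg₀ : ∀ n, 1 ≤ n → IsL10 (g₀ n)) :
    ∃ u : ℝ → (n : ℕ) → L1 ν n,
      -- `u` is a strong solution with the given initial data
      (IsStrongSolution Φ u ∧ ∀ n, 1 ≤ n → u 0 n =ᵐ[volume] g₀ n) ∧
      -- it is the only one
      (∀ v : ℝ → (n : ℕ) → L1 ν n, IsStrongSolution Φ v →
        (∀ n, 1 ≤ n → v 0 n =ᵐ[volume] g₀ n) → ∀ t n, 1 ≤ n → v t n = u t n) ∧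
      -- it is given by the cluster expansion
      (∀ t n, 1 ≤ n → u t n =ᵐ[volume] clusterExpansion Φ g₀ t n) ∧
      -- it stays in the space of the initial data and satisfies the hierarchy there classically
      (∀ t n, 1 ≤ n → IsL10 (clusterExpansion Φ g₀ t n) ∧
        ∃ v : L1 ν n, HasDerivAt (fun s => u s n) v t ∧
          v =ᵐ[volume] hierarchyRHS Φ (clusterExpansion Φ g₀ t) n) ∧
      -- the norm estimate
      (∀ t n, 1 ≤ n → ‖u t n‖ ≤ (n ! : ℝ) * Real.exp (n + 1) *
        ∑ P : Finpartition (Finset.univ : Finset (Fin n)),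
          ∏ X ∈ P.parts, ∫ x, |g₀ X.card x|) := by
  have h0 : ∀ n, 1 ≤ n → clusterSolution Φ g₀ 0 n =ᵐ[volume] g₀ n := fun n hn =>
    (coeFn_clusterSolution hΦ hg₀ 0 hn).trans (.of_forall
      (clusterExpansion_zero hΦ (fun n hn => (hg₀ n hn).symm) hn))
  have hu := isStrongSolution_clusterSolution hΦ hg₀
  refine ⟨clusterSolution Φ g₀, ⟨hu, h0⟩, fun v hv hv0 t n hn => ?_,
    fun t n hn => coeFn_clusterSolution hΦ hg₀ t hn,
    fun t n hn => ⟨isL10_clusterExpansion hΦ hg₀ t hn,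
      exists_hasDerivAt_clusterSolution hΦ hg₀ t hn⟩, fun t n hn => ?_⟩
  · exact hv.eq_of_initial_eq hΦ hu
      (fun n hn => Lp.ext ((hv0 n hn).trans (h0 n hn).symm)) n hn t
  · rw [L1.norm_eq_integral_norm]
    refine le_of_eq_of_le (integral_congr_ae ?_) (integral_abs_clusterExpansion_le hΦ hg₀ hn t)
    filter_upwards [coeFn_clusterSolution hΦ hg₀ t hn] with x hx
    rw [hx, Real.norm_eq_abs]
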